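/- **Theorem 2.** Let $\nu$ be a probability law on $\{0,1,2,\ldots\}$, let $\xi$ have law $\nu$, and let $f(s)=\mathbf{E}s^{\xi}$. Suppose that $\mathbf{E}\xi=1$ and that, for some $\alpha\in(0,1)$, $$f(s)=s+(1-s)^{1+\alpha}L(1-s),\qquad 0\le s\le 1,$$ where $L(z)$ is slowly varying as $z\downarrow 0$. Consider a Galton–Watson process with offspring law $\nu$ that starts from a single ancestor in generation $0$. Let $Z(n)$ be the number of particles in generation $n$, and for $0\le m\le n$ let $Z(m,n)$ be the number of particles in generation $m$ that have at least one descendant in generation $n$ (with $Z(n,n)=Z(n)$). Let $f_0(s)=s$, $f_n(s)=f(f_{n-1}(s))$ be the iterates of $f$. Let $\varphi(n)$ be a deterministic real function such that $\varphi(n)\to\infty$ and $\varphi(n)/n\to 0$ as $n\to\infty$, and put $$\mathcal{H}(n)=\{0<(1-f_{\lfloor\varphi(n)\rfloor}(0))\,Z(n)\le 1\}.$$ There is exactly one probability law $M$ on $[0,\infty)$ with $$\int_{[0,\infty)}e^{-\lambda y}\,dM(y)=1-\frac{1}{(1+\lambda^{-\alpha})^{1/\alpha}},\qquad \lambda>0,$$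 and for every $x\in(0,\infty)$ and every integer $j\ge 1$ $$\lim_{n\to\infty}\mathbf{P}\bigl(Z(\lfloor n-x\varphi(n)\rfloor,n)=j\,\big|\,\mathcal{H}(n)\bigr)=\frac{\alpha\,\Gamma(j+\alpha)}{j!}\,x\,M^{*j}(x^{-1/\alpha}),$$ where $M^{*j}(y)$ is the distribution function of the $j$-fold convolution of $M$ with itself. -/

import Mathlib

open MeasureTheory ProbabilityTheory Filter Topology
open scoped MeasureTheory

namespace GaltonWatson

/-- Probability generating function `f(s) = E s^ξ` of the offspring law `ν`. -/
noncomputable def genFun (ν : Measure ℕ) (s : ℝ) : ℝ := ∫ k, s ^ k ∂ν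

/-- `L` is slowly varying as `z ↓ 0`. -/
def SlowlyVaryingAtZero (L : ℝ → ℝ) : Prop :=
  (∀ᶠ z in 𝓝[>] (0 : ℝ), 0 < L z) ∧
    ∀ c : ℝ, 0 < c → Tendsto (fun z => L (c * z) / L z) (𝓝[>] 0) (𝓝 1)

/-- The offspring law `ν` has mean one, and `f(s) = s + (1 - s)^(1+α) L(1 - s)` on `[0, 1]`
with `L` slowly varying at zero. -/
structure CriticalOffspring (α : ℝ) (L : ℝ → ℝ) (ν : Measure ℕ) : Prop where
  mean_one : ∫ k, (k : ℝ) ∂ν = 1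
  slowlyVarying : SlowlyVaryingAtZero L
  genFun_eq : ∀ s : ℝ, 0 ≤ s → s ≤ 1 → genFun ν s = s + (1 - s) ^ (1 + α) * L (1 - s)

/-- Particles of generation `n` in the family tree with offspring numbers `c`. A particle is
labelled by a word; its children, numbered from `0`, are the words `i :: u` with `i < c u`. -/
def generation (c : List ℕ → ℕ) : ℕ → Finset (List ℕ)
  | 0 => {[]}
  | n + 1 => (generation c n).biUnion fun u => (Finset.range (c u)).image fun i => i :: u

/-- Size `Z(n)` of generation `n`. -/
def popSize (c : List ℕ → ℕ) (n : ℕ) : ℕ := (generation c n).card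

/-- `Z(m, n)`: number of particles of generation `m` that have a descendant in generation `n`.
The descendants of `u` are the words that end in `u`; a particle is a descendant of itself. -/
def reducedSize (c : List ℕ → ℕ) (m n : ℕ) : ℕ :=
  ((generation c m).filter fun u => ∃ v ∈ generation c n, u <:+ v).card

/-- The family `ξ`, indexed by all possible particles, consists of independent random variables
with law `ν`; the family tree with offspring numbers `ξ u` is then a Galton-Watson tree. -/
structure IsOffspringFamily {Ω : Type*} [MeasurableSpace Ω] (P : Measure Ω)
    (ν : Measure ℕ) (ξ : List ℕ → Ω → ℕ) : Prop where
  measurable : ∀ u, Measurable (ξ u)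
  law : ∀ u, P.map (ξ u) = ν
  indep : iIndepFun ξ P

/-- The small-deviation event `0 < (1 - f_k(0)) Z(n) ≤ 1`, where `f_k` is the `k`-th iterate
of the generating function of the offspring law. -/
def smallDev {Ω : Type*} (ν : Measure ℕ) (ξ : List ℕ → Ω → ℕ) (k n : ℕ) : Set Ω :=
  {ω | 0 < (1 - (genFun ν)^[k] 0) * (popSize (fun u => ξ u ω) n : ℝ) ∧
    (1 - (genFun ν)^[k] 0) * (popSize (fun u => ξ u ω) n : ℝ) ≤ 1}

/-- `M` is a probability law on `[0, ∞)` with Laplace transform `1 - (1 + l^(-α))^(-1/α)`. -/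
structure IsSlackLaw (α : ℝ) (M : Measure ℝ) : Prop where
  prob : IsProbabilityMeasure M
  nonneg : M (Set.Iio 0) = 0
  laplace : ∀ l : ℝ, 0 < l →
    ∫ y, Real.exp (-(l * y)) ∂M = 1 - 1 / (1 + l ^ (-α)) ^ (1 / α)

/-- The `j`-fold convolution of `M` with itself. -/
noncomputable def convPow (M : Measure ℝ) : ℕ → Measure ℝ
  | 0 => Measure.dirac 0
  | j + 1 => Measure.conv (convPow M j) M

end GaltonWatson

namespace GaltonWatson

/-! Work in the coordinate `q = 1 - s`, where `f` becomes `g = survival ν`, and put `Q_n = g^[n] 1 =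
P(Z(n) > 0)`. The relative decrement of `g` is `q ^ α * L q`, monotone and regularly varying.

Analytic half. The number `N(q)` of orbit points above `q` satisfies `N(q) * decr g q → 1 / α`
(`tendsto_hitting_mul_decr`). Hence `Q_a / Q_b → t ^ (-1/α)` when `a / b → t`, and the increments
`Δ_n = Q_n - Q_{n+1}` are asymptotically equal along equivalent indices. A start `q ~ t Q_m` behaves
like the orbit point with index about `t ^ (-α) m`. This gives `Q_p - g^[p] q ~ t ^ (-α) m Δ_p` if
`m = o(p)`, and the limit of `g^[k] q / Q_k` if `k ~ x m`.

Probabilistic half. With `p + k = n`, the branching property gives `E[s ^ Z(n) t ^ Z(p,n); Z(n) > 0]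
= g^[p] Q_k - g^[p] (Q_k - t (Q_k - g^[k] (1 - s)))`. For `s = exp (-c Q_m)` and `k ~ x m`, division
by `m Δ_n` yields the limit `x ((1 - t Φ(c)) ^ (-α) - 1)`, where `Φ(c)` is the Laplace transform of
`M` at `c x ^ (1/α)`. The coefficient of `t ^ j` is `x Γ(j+α) / (Γ(α) j!) Φ(c) ^ j`, a multiple of
the transform of `M^{*j}`. Without `t` the limit is `c ^ (-α)`, the transform of `y ^ (α-1) / Γ(α)
dy`, so the conditioning event has probability `~ m Δ_n / Γ(α+1)`. The ratio of the two masses of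
`{Q_m Z(n) ≤ 1}` is the claim.

Both passages from transforms to masses use one moment method
(`UnitWeight.tendsto_integral_mul_continuous`, `UnitWeight.tendsto_integral_ite`) for variables in
`[0, 1]`: first `2 ^ (-Z(p,n))` to isolate `j`, then `exp (-Q_m Z(n))` to cut at level one. The
limit has no atom at the cut because it is dominated by a multiple of the gamma-type limit
(`UnitWeight.ae_ne_of_le`). Existence of `M` comes from compactness of the laws of `exp (-Q_n Z(n))`
given survival, uniqueness from integer moments. -/

/-! ### Regularly varying maps and the orbit of one -/

/-- The relative decrement `1 - g q / q` of a map `g` at `q`. -/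
noncomputable def decr (g : ℝ → ℝ) (q : ℝ) : ℝ := 1 - g q / q

/-- A monotone self-map `g` of `(0, 1]` lying below the identity, whose relative decrement is
monotone and regularly varying at zero with index `α`. -/
structure RegVarStep (α : ℝ) (g : ℝ → ℝ) : Prop where
  pos : ∀ q, 0 < q → q ≤ 1 → 0 < g q
  lt : ∀ q, 0 < q → q ≤ 1 → g q < q
  mono : MonotoneOn g (Set.Ioc 0 1)
  decr_mono : MonotoneOn (decr g) (Set.Ioc 0 1)
  decr_rv : ∀ c : ℝ, 0 < c → Tendsto (fun q => decr g (c * q) / decr g q) (𝓝[>] 0) (𝓝 (c ^ α))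

theorem tendsto_const_mul_nhdsGT_zero {c : ℝ} (hc : 0 < c) :
    Tendsto (fun q : ℝ => c * q) (𝓝[>] 0) (𝓝[>] 0) := by
  rw [tendsto_nhdsWithin_iff]
  refine ⟨?_, ?_⟩
  · have : Tendsto (fun q : ℝ => c * q) (𝓝 0) (𝓝 (c * 0)) :=
      (continuous_const.mul continuous_id).tendsto 0
    rw [mul_zero] at this
    exact this.mono_left nhdsWithin_le_nhds
  · filter_upwards [self_mem_nhdsWithin] with q hq
    exact mul_pos hc hq

/-- If `u q ≤ ρ u (q / r) + C` near zero with `ρ < 1`, then `limsup u ≤ C / (1 - ρ)` at zero. -/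
theorem eventually_le_of_le_mul_add {u : ℝ → ℝ} {r ρ C δ B K : ℝ} (hr₀ : 0 < r) (hr₁ : r < 1)
    (hρ₀ : 0 ≤ ρ) (hρ₁ : ρ < 1) (hδ : 0 < δ) (hu : ∀ q, 0 < q → q < δ → u q ≤ ρ * u (q / r) + C)
    (hB : ∀ q, δ ≤ q → q < δ / r → u q ≤ B) (hK : C / (1 - ρ) < K) :
    ∀ᶠ q in 𝓝[>] 0, u q ≤ K := by
  set D := C / (1 - ρ) with hD
  have hCD : C = D * (1 - ρ) := by rw [hD]; field_simp [(sub_pos.2 hρ₁).ne']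
  -- `D` is the fixed point of `v ↦ ρ v + C`; subtracting it leaves a pure contraction.
  have hv : ∀ q, 0 < q → q < δ → u q - D ≤ ρ * (u (q / r) - D) := by
    intro q h0 h1
    have := hu q h0 h1
    rw [hCD] at this; linarith
  set B' := max (B - D) 0 with hB'
  have hB'0 : 0 ≤ B' := le_max_right _ _
  -- Division by `r` brings any small `q` into the window `[δ, δ / r)` in finitely many steps, and a
  -- nonnegative bound survives each step because `ρ < 1`.
  have step1 : ∀ j : ℕ, ∀ q, δ * r ^ j ≤ q → q < δ / r → u q - D ≤ B' := by
    intro j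
    induction j with
    | zero =>
      intro q h1 h2
      have := hB q (by simpa using h1) h2
      exact le_trans (by linarith) (le_max_left _ _)
    | succ j ih =>
      intro q h1 h2
      have hq0 : 0 < q := lt_of_lt_of_le (by positivity) h1
      by_cases hq : q < δ
      · have h3 : δ * r ^ j ≤ q / r := by
          rw [le_div_iff₀ hr₀]; calc _ = δ * r ^ (j + 1) := by ring
            _ ≤ q := h1
        have h4 : q / r < δ / r := by gcongr
        have := hv q hq0 hq
        nlinarith [ih (q / r) h3 h4]
      · exact le_trans (by linarith [hB q (not_lt.1 hq) h2]) (le_max_left _ _)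
  have step1' : ∀ q, 0 < q → q < δ / r → u q - D ≤ B' := by
    intro q h0 h1
    obtain ⟨j, hj⟩ := exists_pow_lt_of_lt_one (show 0 < q / δ by positivity) hr₁
    refine step1 j q ?_ h1
    rw [lt_div_iff₀ hδ] at hj; linarith
  -- Once a uniform bound is known, every further factor `r` in the scale gains a factor `ρ`.
  have step2 : ∀ i : ℕ, ∀ q, 0 < q → q < δ / r * r ^ i → u q - D ≤ ρ ^ i * B' := by
    intro i
    induction i with
    | zero => intro q h0 h1; simpa using step1' q h0 (by simpa using h1)
    | succ i ih =>
      intro q h0 h1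
      have hlt : q / r < δ / r * r ^ i := by
        rw [div_lt_iff₀ hr₀]; calc q < _ := h1
          _ = _ := by ring
      have h2 := ih (q / r) (by positivity) hlt
      have hqδ : q < δ := by
        refine h1.trans_le ?_
        have : r ^ i ≤ 1 := pow_le_one₀ hr₀.le hr₁.le
        calc δ / r * r ^ (i + 1) = δ * r ^ i := by field_simp; ring
          _ ≤ δ := by nlinarith
      calc u q - D ≤ ρ * (u (q / r) - D) := hv q h0 hqδ
        _ ≤ ρ * (ρ ^ i * B') := by gcongr
        _ = _ := by ring
  have hlim : Tendsto (fun i : ℕ => ρ ^ i * B') atTop (𝓝 0) := by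
    simpa using (tendsto_pow_atTop_nhds_zero_of_lt_one hρ₀ hρ₁).mul_const B'
  obtain ⟨i, hi⟩ := (hlim.eventually (gt_mem_nhds (sub_pos.2 hK))).exists
  have hpos : 0 < δ / r * r ^ i := by positivity
  filter_upwards [Ioo_mem_nhdsGT hpos] with q hq
  linarith [step2 i q hq.1 hq.2]

namespace RegVarStep

variable {α : ℝ} {g : ℝ → ℝ}

theorem decr_pos (h : RegVarStep α g) {q : ℝ} (h0 : 0 < q) (h1 : q ≤ 1) : 0 < decr g q := by
  have := h.lt q h0 h1
  rw [decr, sub_pos, div_lt_one h0]; exact this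

theorem decr_lt_one (h : RegVarStep α g) {q : ℝ} (h0 : 0 < q) (h1 : q ≤ 1) : decr g q < 1 := by
  have := h.pos q h0 h1
  have : 0 < g q / q := by positivity
  rw [decr]; linarith

theorem eq_mul_decr (g : ℝ → ℝ) {q : ℝ} (h0 : 0 < q) : g q = q * (1 - decr g q) := by
  rw [decr]; field_simp; ring

theorem iterate_pos (h : RegVarStep α g) (n : ℕ) {q : ℝ} (h0 : 0 < q) (h1 : q ≤ 1) :
    0 < g^[n] q ∧ g^[n] q ≤ 1 := by
  induction n with
  | zero => exact ⟨h0, h1⟩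
  | succ n ih =>
    rw [Function.iterate_succ_apply']
    exact ⟨h.pos _ ih.1 ih.2, (h.lt _ ih.1 ih.2).le.trans ih.2⟩

theorem iterate_mono (h : RegVarStep α g) (n : ℕ) {q r : ℝ} (h0 : 0 < q) (hqr : q ≤ r)
    (h1 : r ≤ 1) : g^[n] q ≤ g^[n] r := by
  induction n with
  | zero => exact hqr
  | succ n ih =>
    rw [Function.iterate_succ_apply', Function.iterate_succ_apply']
    exact h.mono (h.iterate_pos n h0 (hqr.trans h1)) (h.iterate_pos n (h0.trans_le hqr) h1) ih

theorem strictAnti (h : RegVarStep α g) : StrictAnti fun n => g^[n] 1 := by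
  refine strictAnti_nat_of_succ_lt fun n => ?_
  rw [Function.iterate_succ_apply']
  have := h.iterate_pos n one_pos le_rfl
  exact h.lt _ this.1 this.2

theorem orbit_pos (h : RegVarStep α g) (n : ℕ) : 0 < g^[n] 1 := (h.iterate_pos n one_pos le_rfl).1

theorem orbit_le_one (h : RegVarStep α g) (n : ℕ) : g^[n] 1 ≤ 1 :=
  (h.iterate_pos n one_pos le_rfl).2

theorem orbit_mem (h : RegVarStep α g) (n : ℕ) : g^[n] 1 ∈ Set.Ioc (0 : ℝ) 1 :=
  h.iterate_pos n one_pos le_rfl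

/-- An orbit staying above `q` would shrink at each step by at least the fixed factor `1 - decr g
q`, since `decr g` is monotone. -/
theorem exists_orbit_le (h : RegVarStep α g) {q : ℝ} (h0 : 0 < q) : ∃ n, g^[n] 1 ≤ q := by
  by_contra! hc
  have hq1 : q ≤ 1 := (hc 0).le
  have hb := h.decr_pos h0 hq1
  have hb1 := h.decr_lt_one h0 hq1
  have key : ∀ n, g^[n] 1 ≤ (1 - decr g q) ^ n := by
    intro n
    induction n with
    | zero => simp
    | succ n ih =>
      rw [Function.iterate_succ_apply', eq_mul_decr g (h.orbit_pos n), pow_succ]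
      have := h.decr_mono ⟨h0, hq1⟩ (h.orbit_mem n) (hc n).le
      have := h.orbit_pos n
      gcongr
      linarith [h.decr_lt_one this (h.orbit_le_one n)]
  obtain ⟨n, hn⟩ := exists_pow_lt_of_lt_one h0 (show 1 - decr g q < 1 by linarith)
  linarith [key n, hc n]

theorem tendsto_orbit (h : RegVarStep α g) : Tendsto (fun n => g^[n] 1) atTop (𝓝[>] 0) := by
  rw [tendsto_nhdsWithin_iff]
  refine ⟨?_, Eventually.of_forall fun n => h.orbit_pos n⟩
  rw [tendsto_order]
  refine ⟨fun a ha => Eventually.of_forall fun n => ha.trans (h.orbit_pos n), fun a ha => ?_⟩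
  obtain ⟨n, hn⟩ := h.exists_orbit_le (half_pos ha)
  filter_upwards [eventually_ge_atTop n] with m hm
  have := h.strictAnti.antitone hm
  linarith

theorem tendsto_decr (h : RegVarStep α g) (hα : 0 < α) : Tendsto (decr g) (𝓝[>] 0) (𝓝 0) := by
  set S := decr g '' Set.Ioc 0 1 with hS
  have hbdd : BddBelow S := ⟨0, by rintro _ ⟨q, hq, rfl⟩; exact (h.decr_pos hq.1 hq.2).le⟩
  have hne : S.Nonempty := ⟨_, 1, ⟨one_pos, le_rfl⟩, rfl⟩
  have hlim : Tendsto (decr g) (𝓝[>] 0) (𝓝 (sInf S)) := by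
    rw [tendsto_order]
    refine ⟨fun a ha => ?_, fun a ha => ?_⟩
    · filter_upwards [Ioc_mem_nhdsGT one_pos] with q hq
      exact ha.trans_le (csInf_le hbdd ⟨q, hq, rfl⟩)
    · obtain ⟨_, ⟨q, hq, rfl⟩, hqa⟩ := exists_lt_of_csInf_lt hne ha
      filter_upwards [Ioc_mem_nhdsGT hq.1] with p hp
      exact (h.decr_mono ⟨hp.1, hp.2.trans hq.2⟩ hq hp.2).trans_lt hqa
  have hnn : 0 ≤ sInf S := le_csInf hne (by
    rintro _ ⟨q, hq, rfl⟩; exact (h.decr_pos hq.1 hq.2).le)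
  rcases hnn.eq_or_lt with h0 | h0
  · rwa [← h0] at hlim
  -- a positive limit contradicts regular variation with a positive index
  exfalso
  have h1 := (hlim.comp (tendsto_const_mul_nhdsGT_zero one_half_pos)).div hlim h0.ne'
  rw [div_self h0.ne'] at h1
  have h2 := tendsto_nhds_unique h1 (h.decr_rv (1 / 2) (by norm_num))
  have h3 : (1 / 2 : ℝ) ^ α < 1 := Real.rpow_lt_one (by norm_num) (by norm_num) hα
  linarith

/-- The number of points of the orbit of `1` that exceed `q`. -/
noncomputable def hitting (g : ℝ → ℝ) (q : ℝ) : ℕ := sInf {n | g^[n] 1 ≤ q}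

theorem lt_hitting_iff (h : RegVarStep α g) {q : ℝ} (h0 : 0 < q) {n : ℕ} :
    n < hitting g q ↔ q < g^[n] 1 := by
  constructor
  · intro hn
    have := Nat.notMem_of_lt_sInf hn
    simpa using this
  · intro hn
    by_contra hc
    have h1 : g^[hitting g q] 1 ≤ q := Nat.sInf_mem (h.exists_orbit_le h0)
    have := h.strictAnti.antitone (not_lt.1 hc)
    linarith

theorem hitting_le_iff (h : RegVarStep α g) {q : ℝ} (h0 : 0 < q) {n : ℕ} :
    hitting g q ≤ n ↔ g^[n] 1 ≤ q := by
  rw [← not_lt, h.lt_hitting_iff h0, not_lt]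

theorem hitting_orbit (h : RegVarStep α g) (n : ℕ) : hitting g (g^[n] 1) = n := by
  apply le_antisymm ((h.hitting_le_iff (h.orbit_pos n)).2 le_rfl)
  by_contra hc
  have := h.strictAnti (not_le.1 hc)
  have h2 := (h.hitting_le_iff (h.orbit_pos n)).1 (le_refl (hitting g (g^[n] 1)))
  linarith

theorem hitting_anti (h : RegVarStep α g) {q r : ℝ} (h0 : 0 < q) (hqr : q ≤ r) :
    hitting g r ≤ hitting g q := by
  rw [h.hitting_le_iff (h0.trans_le hqr)]
  exact ((h.hitting_le_iff h0).1 le_rfl).trans hqr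

/-- Above `q` each step multiplies the orbit by at most `1 - decr g q ≤ exp (-decr g q)`, so the
passage from `r` to `q` takes at most `log (r / q) / decr g q` steps, up to one. -/
theorem hitting_sub_mul_le (h : RegVarStep α g) {q r : ℝ} (h0 : 0 < q) (hqr : q ≤ r)
    (h1 : r ≤ 1) :
    ((hitting g q : ℝ) - hitting g r) * decr g q ≤ Real.log (r / q) + decr g q := by
  have hb := h.decr_pos h0 (hqr.trans h1)
  have hb1 := h.decr_lt_one h0 (hqr.trans h1)
  have hr0 := h0.trans_le hqr
  have hlog : 0 ≤ Real.log (r / q) := Real.log_nonneg (by rwa [le_div_iff₀ h0, one_mul])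
  have key : ∀ i : ℕ, hitting g r + i < hitting g q →
      g^[hitting g r + i] 1 ≤ r * (1 - decr g q) ^ i := by
    intro i
    induction i with
    | zero => intro _; simpa using (h.hitting_le_iff hr0).1 le_rfl
    | succ i ih =>
      intro hi
      have ih' := ih (by omega)
      have hq := (h.lt_hitting_iff h0).1 (show hitting g r + i < hitting g q by omega)
      rw [← add_assoc, Function.iterate_succ_apply', eq_mul_decr g (h.orbit_pos _), pow_succ,
        ← mul_assoc]
      have := h.decr_mono ⟨h0, hqr.trans h1⟩ (h.orbit_mem _) hq.le
      gcongr
      linarith [h.decr_lt_one (h.orbit_pos (hitting g r + i)) (h.orbit_le_one _)]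
  by_cases hlt : hitting g r < hitting g q
  · obtain ⟨i, hi⟩ := Nat.exists_eq_add_of_lt hlt
    have h2 := key i (by omega)
    have h3 := (h.lt_hitting_iff h0).1 (show hitting g r + i < hitting g q by omega)
    have h4 : (1 - decr g q) ^ i ≤ Real.exp (-(i * decr g q)) := by
      have := Real.one_sub_le_exp_neg (decr g q)
      calc (1 - decr g q) ^ i ≤ (Real.exp (-decr g q)) ^ i := by
            gcongr
        _ = _ := by rw [← Real.exp_nat_mul]; ring_nf
    have h5 : q < r * Real.exp (-(i * decr g q)) := (h3.trans_le h2).trans_le (by gcongr)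
    have h6 : Real.exp (i * decr g q) ≤ r / q := by
      rw [le_div_iff₀ h0]
      rw [Real.exp_neg, ← div_eq_mul_inv, lt_div_iff₀ (Real.exp_pos _)] at h5
      linarith
    have h7 : i * decr g q ≤ Real.log (r / q) := by
      rwa [Real.le_log_iff_exp_le (by positivity)]
    rw [hi]; push_cast; nlinarith
  · have : (hitting g q : ℝ) ≤ hitting g r := by exact_mod_cast not_lt.1 hlt
    nlinarith

/-- The converse count: below `r` each step keeps at least the factor `1 - decr g r`. -/
theorem log_le_hitting_sub_mul (h : RegVarStep α g) {q r : ℝ} (h0 : 0 < q) (hqr : q ≤ r)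
    (h1 : r ≤ 1) :
    Real.log (r / q) ≤ ((hitting g q : ℝ) - hitting g r + 1) * -Real.log (1 - decr g r) := by
  have hr0 := h0.trans_le hqr
  have hb := h.decr_pos hr0 h1
  have hb1 := h.decr_lt_one hr0 h1
  have hone : 0 < 1 - decr g r := by linarith
  -- The first orbit point below `r` overshoots by at most one step of `g` from `r`; this is the
  -- extra `1` in the bound.
  have base : r * (1 - decr g r) ≤ g^[hitting g r] 1 := by
    rcases Nat.eq_zero_or_pos (hitting g r) with hz | hz
    · rw [hz]; simp only [Function.iterate_zero, id]; nlinarith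
    · obtain ⟨k, hk⟩ := Nat.exists_eq_succ_of_ne_zero hz.ne'
      have h3 := (h.lt_hitting_iff hr0).1 (show k < hitting g r by omega)
      rw [hk, Nat.succ_eq_add_one, Function.iterate_succ_apply', ← eq_mul_decr g hr0]
      exact h.mono ⟨hr0, h1⟩ (h.orbit_mem _) h3.le
  have key : ∀ i : ℕ, r * (1 - decr g r) ^ (i + 1) ≤ g^[hitting g r + i] 1 := by
    intro i
    induction i with
    | zero => simpa using base
    | succ i ih =>
      rw [← add_assoc, Function.iterate_succ_apply', eq_mul_decr g (h.orbit_pos _), pow_succ,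
        ← mul_assoc]
      have h3 : g^[hitting g r + i] 1 ≤ r := (h.hitting_le_iff hr0).1 (Nat.le_add_right _ _)
      have := h.decr_mono (h.orbit_mem _) ⟨hr0, h1⟩ h3
      have := h.orbit_pos (hitting g r + i)
      gcongr
  obtain ⟨i, hi⟩ := Nat.exists_eq_add_of_le (h.hitting_anti h0 hqr)
  have h2 := key i
  have h3 : g^[hitting g r + i] 1 ≤ q := by
    rw [← hi]; exact (h.hitting_le_iff h0).1 le_rfl
  have h4 : r * (1 - decr g r) ^ (i + 1) ≤ q := h2.trans h3
  have h5 : r / q ≤ ((1 - decr g r) ^ (i + 1))⁻¹ := by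
    rw [div_le_iff₀ h0, ← div_eq_inv_mul, le_div_iff₀ (by positivity)]; exact h4
  have h6 := Real.log_le_log (by positivity) h5
  rw [Real.log_inv, Real.log_pow] at h6
  rw [hi]; push_cast at h6 ⊢; linarith

end RegVarStep
-- Sharp asymptotics of the hitting count
theorem tendsto_neg_log_one_sub_div {ι : Type*} {l : Filter ι} {b : ι → ℝ}
    (hb : Tendsto b l (𝓝 0)) (hb0 : ∀ᶠ i in l, b i ≠ 0) :
    Tendsto (fun i => -Real.log (1 - b i) / b i) l (𝓝 1) := by
  have hd : HasDerivAt (fun y : ℝ => -Real.log (1 - y)) 1 0 := by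
    have h1 : HasDerivAt (fun y : ℝ => 1 - y) (-1) 0 := by
      simpa using (hasDerivAt_id (0 : ℝ)).const_sub 1
    have := (h1.log (by norm_num)).fun_neg
    simpa using this
  rw [hasDerivAt_iff_tendsto_slope] at hd
  have h2 : Tendsto b l (𝓝[≠] 0) := tendsto_nhdsWithin_iff.2 ⟨hb, hb0⟩
  refine (hd.comp h2).congr fun i => ?_
  simp [slope_def_field]

namespace RegVarStep

variable {α : ℝ} {g : ℝ → ℝ}

/-- For `u q = hitting g q * decr g q` and `r = exp (-t)`, counting steps between `q / r` and `q`
gives `u q ≤ r ^ α * u (q / r) + t` up to small errors. The fixed point `t / (1 - exp (-α t))` tends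
to `1 / α` as `t → 0`, so it falls below `K`. -/
theorem eventually_hitting_mul_decr_le (h : RegVarStep α g) (hα : 0 < α) {K : ℝ}
    (hK : 1 / α < K) : ∀ᶠ q in 𝓝[>] 0, hitting g q * decr g q ≤ K := by
  have hK0 : 0 < K := lt_trans (by positivity) hK
  have hαK : 0 < α * K - 1 := by rw [div_lt_iff₀ hα] at hK; linarith
  -- a step ratio `r = exp (-t)` close to one
  set t : ℝ := (α * K - 1) / (2 * α) with ht
  have ht0 : 0 < t := by positivity
  set r : ℝ := Real.exp (-t) with hr
  have hr0 : 0 < r := Real.exp_pos _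
  have hr1 : r < 1 := by rw [hr, Real.exp_lt_one_iff]; linarith
  have hrα : r ^ α = Real.exp (-(α * t)) := by
    rw [hr, ← Real.exp_mul]; ring_nf
  -- The choice of `t` makes `1 + α t` the midpoint of `1` and `α K`; the bound `exp (α t) ≥ 1 + α
  -- t` then suffices.
  have hd : 0 < K * (1 - r ^ α) - t := by
    have h1 : r ^ α ≤ 1 / (1 + α * t) := by
      rw [hrα, Real.exp_neg, ← one_div]
      exact one_div_le_one_div_of_le (by positivity) (by linarith [Real.add_one_le_exp (α * t)])
    have h2 : t < K * (1 - 1 / (1 + α * t)) := by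
      have : K * (1 - 1 / (1 + α * t)) = K * α * t / (1 + α * t) := by
        field_simp; ring
      rw [this, lt_div_iff₀ (by positivity)]
      have : 1 + α * t < K * α := by
        have : α * t = (α * K - 1) / 2 := by rw [ht]; field_simp
        linarith
      nlinarith
    nlinarith
  -- The slack `d` is shared out: a quarter pays for the error in the ratio, a quarter for the error
  -- in the constant, and half remains for the strict inequality.
  set d := K * (1 - r ^ α) - t with hd'
  set ρ := r ^ α + d / (4 * K) with hρ
  set C := t + d / 4 with hC
  have hKρ : K * (1 - ρ) = t + 3 * d / 4 := by
    have : K * (d / (4 * K)) = d / 4 := by field_simp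
    rw [hρ]; linarith
  have hρ1 : ρ < 1 := by
    by_contra hc
    have : K * (1 - ρ) ≤ 0 := mul_nonpos_of_nonneg_of_nonpos hK0.le (by linarith)
    linarith
  have hρ0 : 0 ≤ ρ := by positivity
  have hCK : C / (1 - ρ) < K := by
    rw [div_lt_iff₀ (by linarith)]; linarith
  have hrv : ∀ᶠ q in 𝓝[>] (0 : ℝ), decr g q / decr g (q / r) < ρ := by
    have h1 := (h.decr_rv r hr0).comp (tendsto_const_mul_nhdsGT_zero (inv_pos.2 hr0))
    have h2 := h1.eventually (gt_mem_nhds (show r ^ α < ρ by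
      rw [hρ]; linarith [show 0 < d / (4 * K) by positivity]))
    filter_upwards [h2] with q hq
    simpa [hr0.ne', div_eq_inv_mul] using hq
  have hb := (h.tendsto_decr hα).eventually (gt_mem_nhds (show 0 < d / 4 by positivity))
  obtain ⟨δ, hδ0, hδ⟩ := mem_nhdsGT_iff_exists_Ioo_subset.1
    (inter_mem (inter_mem hrv hb) (Ioo_mem_nhdsGT hr0))
  have hδ0 : 0 < δ := hδ0
  have hδr : δ ≤ r := by
    by_contra hc
    have : (max r (δ / 2)) ∈ Set.Ioo 0 δ :=
      ⟨lt_max_of_lt_left hr0, max_lt (not_le.1 hc) (by linarith)⟩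
    have := (hδ this).2.2
    exact absurd (le_max_left r (δ / 2)) (not_le.2 this)
  -- On the starting window the count is at most its value at `δ` and the decrement is below one,
  -- whence the bound `hitting g δ`.
  refine eventually_le_of_le_mul_add (u := fun q => hitting g q * decr g q) (B := hitting g δ)
    hr0 hr1 hρ0 hρ1 hδ0 ?_ ?_ hCK
  · intro q hq0 hqδ
    obtain ⟨⟨h1, h2⟩, -⟩ := hδ ⟨hq0, hqδ⟩
    simp only [Set.mem_ofPred_eq] at h1 h2
    have hqr0 : 0 < q / r := by positivity
    have hqr : q / r ≤ 1 := by rw [div_le_one hr0]; linarith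
    have hle : q ≤ q / r := by rw [le_div_iff₀ hr0]; nlinarith
    have h3 := h.hitting_sub_mul_le hq0 hle hqr
    have h4 : q / r / q = r⁻¹ := by field_simp
    rw [h4, hr, ← Real.exp_neg, neg_neg, Real.log_exp, ← hr] at h3
    rw [div_lt_iff₀ (h.decr_pos hqr0 hqr)] at h1
    have h5 : (hitting g (q / r) : ℝ) * decr g q ≤ hitting g (q / r) * (ρ * decr g (q / r)) := by
      gcongr
    nlinarith
  · intro q h1 h2
    have hq0 : 0 < q := hδ0.trans_le h1
    have hq1 : q ≤ 1 := by
      refine h2.le.trans ?_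
      rwa [div_le_one hr0]
    have h3 : (hitting g q : ℝ) ≤ hitting g δ := by exact_mod_cast h.hitting_anti hδ0 h1
    have h4 := h.decr_lt_one hq0 hq1
    have h5 := h.decr_pos hq0 hq1
    nlinarith [(Nat.cast_nonneg (hitting g q) : (0 : ℝ) ≤ _)]

/-- The same contraction is applied to `-u`. Here the step count gives `u q ≥ r ^ α * u (q / r) + r
^ α * t` up to small errors, with fixed point `r ^ α * t / (1 - r ^ α)`, again tending to `1 / α`.
-/
theorem eventually_le_hitting_mul_decr (h : RegVarStep α g) (hα : 0 < α) {K : ℝ}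
    (hK : K < 1 / α) : ∀ᶠ q in 𝓝[>] 0, K ≤ hitting g q * decr g q := by
  rcases le_or_gt K 0 with hK0 | hK0
  · filter_upwards [Ioc_mem_nhdsGT one_pos] with q hq
    exact hK0.trans (mul_nonneg (Nat.cast_nonneg _) (h.decr_pos hq.1 hq.2).le)
  have hαK : 0 < 1 - α * K := by rw [lt_div_iff₀ hα] at hK; linarith
  set t : ℝ := (1 - α * K) / (2 * α) with ht
  have ht0 : 0 < t := by positivity
  have hαt : α * t = (1 - α * K) / 2 := by rw [ht]; field_simp
  have hαt1 : α * t < 1 := by rw [hαt]; nlinarith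
  set r : ℝ := Real.exp (-t) with hr
  have hr0 : 0 < r := Real.exp_pos _
  have hr1 : r < 1 := by rw [hr, Real.exp_lt_one_iff]; linarith
  have hrα : r ^ α = Real.exp (-(α * t)) := by
    rw [hr, ← Real.exp_mul]; ring_nf
  have hrα0 : 0 < r ^ α := by positivity
  have hrα1 : r ^ α < 1 := by rw [hrα, Real.exp_lt_one_iff]; nlinarith
  have hd : 0 < r ^ α * t - K * (1 - r ^ α) := by
    have h1 : 1 - α * t ≤ r ^ α := by
      rw [hrα]; linarith [Real.one_sub_le_exp_neg (α * t)]
    have : K < (1 - α * t) / α := by rw [lt_div_iff₀ hα]; linarith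
    rw [lt_div_iff₀ hα] at this
    nlinarith
  set d := r ^ α * t - K * (1 - r ^ α) with hd'
  -- The contraction lemma needs a nonnegative ratio, which the subtraction alone does not
  -- guarantee.
  set ρ := max 0 (r ^ α - d / (4 * K)) with hρ
  set C := r ^ α * t - d / 4 with hC
  have hρ0 : 0 ≤ ρ := le_max_left _ _
  have hρ1 : ρ < 1 := max_lt one_pos (by linarith [show 0 < d / (4 * K) by positivity])
  have hρlt : ρ < r ^ α := max_lt hrα0 (by linarith [show 0 < d / (4 * K) by positivity])
  have hCK : -C / (1 - ρ) < -K := by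
    rw [div_lt_iff₀ (by linarith)]
    have : r ^ α - d / (4 * K) ≤ ρ := le_max_right _ _
    have h2 : K * (d / (4 * K)) = d / 4 := by field_simp
    nlinarith
  have hscale := tendsto_const_mul_nhdsGT_zero (inv_pos.2 hr0)
  have hrv' : Tendsto (fun q => decr g q / decr g (q / r)) (𝓝[>] (0 : ℝ)) (𝓝 (r ^ α)) := by
    refine ((h.decr_rv r hr0).comp hscale).congr fun q => ?_
    simp [hr0.ne', div_eq_inv_mul]
  have hrv := hrv'.eventually (lt_mem_nhds hρlt)
  have hlog : Tendsto (fun q => -Real.log (1 - decr g (q / r)) / decr g (q / r)) (𝓝[>] 0)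
      (𝓝 1) := by
    have hs : Tendsto (fun q : ℝ => q / r) (𝓝[>] 0) (𝓝[>] 0) :=
      hscale.congr fun q => by rw [div_eq_inv_mul]
    refine tendsto_neg_log_one_sub_div ((h.tendsto_decr hα).comp hs) ?_
    filter_upwards [hs (Ioc_mem_nhdsGT one_pos)] with q hq
    exact (h.decr_pos hq.1 hq.2).ne'
  have hadd : Tendsto (fun q => (t / (-Real.log (1 - decr g (q / r)) / decr g (q / r))) *
      (decr g q / decr g (q / r)) - decr g q) (𝓝[>] 0) (𝓝 (t / 1 * r ^ α - 0)) :=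
    ((tendsto_const_nhds.div hlog one_ne_zero).mul hrv').sub (h.tendsto_decr hα)
  have hC' := hadd.eventually (lt_mem_nhds (show C < t / 1 * r ^ α - 0 by
    rw [hC, div_one, sub_zero, mul_comm]; linarith [show 0 < d / 4 by positivity]))
  obtain ⟨δ, hδ0, hδ⟩ := mem_nhdsGT_iff_exists_Ioo_subset.1
    (inter_mem (inter_mem hrv hC') (Ioo_mem_nhdsGT hr0))
  have hδ0 : 0 < δ := hδ0
  have hδr : δ ≤ r := by
    by_contra hc
    have : (max r (δ / 2)) ∈ Set.Ioo 0 δ :=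
      ⟨lt_max_of_lt_left hr0, max_lt (not_le.1 hc) (by linarith)⟩
    have := (hδ this).2.2
    exact absurd (le_max_left r (δ / 2)) (not_le.2 this)
  have := eventually_le_of_le_mul_add (u := fun q => -(hitting g q * decr g q)) (B := 0) (C := -C)
    hr0 hr1 hρ0 hρ1 hδ0 ?_ ?_ hCK
  · filter_upwards [this] with q hq
    linarith
  · intro q hq0 hqδ
    obtain ⟨⟨h1, h2⟩, -⟩ := hδ ⟨hq0, hqδ⟩
    simp only [Set.mem_ofPred_eq] at h1 h2
    have hqr0 : 0 < q / r := by positivity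
    have hqr : q / r ≤ 1 := by rw [div_le_one hr0]; linarith
    have hle : q ≤ q / r := by rw [le_div_iff₀ hr0]; nlinarith
    have h3 := h.log_le_hitting_sub_mul hq0 hle hqr
    have h4 : q / r / q = r⁻¹ := by field_simp
    rw [h4, hr, ← Real.exp_neg, neg_neg, Real.log_exp, ← hr] at h3
    have hb := h.decr_pos hqr0 hqr
    have hb1 := h.decr_lt_one hqr0 hqr
    have hb' := h.decr_pos hq0 (hle.trans hqr)
    have hlg : 0 < -Real.log (1 - decr g (q / r)) := by
      rw [neg_pos]; exact Real.log_neg (by linarith) (by linarith)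
    rw [← div_le_iff₀ hlg] at h3
    have h6 : t / (-Real.log (1 - decr g (q / r)) / decr g (q / r)) *
        (decr g q / decr g (q / r)) = t / (-Real.log (1 - decr g (q / r))) * decr g q := by
      field_simp
    rw [h6] at h2
    rw [lt_div_iff₀ hb] at h1
    have h5 : (hitting g (q / r) : ℝ) * (ρ * decr g (q / r)) ≤ hitting g (q / r) * decr g q := by
      gcongr
    have h7 := mul_le_mul_of_nonneg_right h3 hb'.le
    nlinarith
  · intro q h1 h2
    have hq0 : 0 < q := hδ0.trans_le h1
    have hq1 : q ≤ 1 := by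
      refine h2.le.trans ?_
      rwa [div_le_one hr0]
    have h5 := h.decr_pos hq0 hq1
    have : 0 ≤ (hitting g q : ℝ) * decr g q := by positivity
    linarith

theorem tendsto_hitting_mul_decr (h : RegVarStep α g) (hα : 0 < α) :
    Tendsto (fun q => hitting g q * decr g q) (𝓝[>] 0) (𝓝 (1 / α)) := by
  rw [tendsto_order]
  refine ⟨fun a ha => ?_, fun a ha => ?_⟩
  · obtain ⟨K, h1, h2⟩ := exists_between ha
    filter_upwards [h.eventually_le_hitting_mul_decr hα h2] with q hq using h1.trans_le hq
  · obtain ⟨K, h1, h2⟩ := exists_between ha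
    filter_upwards [h.eventually_hitting_mul_decr_le hα h1] with q hq using hq.trans_lt h2

theorem tendsto_mul_decr_orbit (h : RegVarStep α g) (hα : 0 < α) :
    Tendsto (fun n : ℕ => n * decr g (g^[n] 1)) atTop (𝓝 (1 / α)) := by
  refine ((h.tendsto_hitting_mul_decr hα).comp h.tendsto_orbit).congr fun n => ?_
  simp [h.hitting_orbit]

/-- `hitting g (c Q_n) / n → c ^ (-α)`, where `Q_n` is the orbit of `1`. -/
theorem tendsto_hitting_const_mul_orbit (h : RegVarStep α g) (hα : 0 < α) {c : ℝ} (hc : 0 < c) :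
    Tendsto (fun n : ℕ => (hitting g (c * g^[n] 1) : ℝ) / n) atTop (𝓝 (c ^ (-α))) := by
  have h1 := ((h.tendsto_hitting_mul_decr hα).comp (tendsto_const_mul_nhdsGT_zero hc)).comp
    h.tendsto_orbit
  have h2 := h.tendsto_mul_decr_orbit hα
  have h3 := (h.decr_rv c hc).comp h.tendsto_orbit
  have hα' : (1 / α) ≠ 0 := by positivity
  have h4 := (h1.div h2 hα').div h3 (by positivity)
  rw [div_self hα', one_div, ← Real.rpow_neg hc.le] at h4
  refine h4.congr' ?_
  have h5 := (tendsto_const_mul_nhdsGT_zero hc).comp h.tendsto_orbit (Ioc_mem_nhdsGT one_pos)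
  filter_upwards [eventually_gt_atTop 0, h5] with n hn hcn
  simp only [Function.comp, Set.mem_preimage] at hcn ⊢
  have e1 := (h.decr_pos hcn.1 hcn.2).ne'
  have e2 := (h.decr_pos (h.orbit_pos n) (h.orbit_le_one n)).ne'
  simp only [Pi.div_apply, Function.comp]
  field_simp

end RegVarStep
-- Orbit ratios, increments and iterates from a shifted start
theorem exists_gt_of_lt_rpow {α t a : ℝ} (ht : 0 < t) (ha : a < t ^ α) :
    ∃ c, t < c ∧ a < c ^ α := by
  have h1 : ContinuousAt (fun c : ℝ => c ^ α) t := Real.continuousAt_rpow_const _ _ (Or.inl ht.ne')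
  have h2 := (h1.eventually (lt_mem_nhds ha)).filter_mono (nhdsWithin_le_nhds (s := Set.Ioi t))
  obtain ⟨c, hc, hc'⟩ := (h2.and self_mem_nhdsWithin).exists
  exact ⟨c, hc', hc⟩

theorem exists_lt_of_rpow_lt {α t a : ℝ} (ht : 0 < t) (ha : t ^ α < a) :
    ∃ c, 0 < c ∧ c < t ∧ c ^ α < a := by
  have h1 : ContinuousAt (fun c : ℝ => c ^ α) t := Real.continuousAt_rpow_const _ _ (Or.inl ht.ne')
  have h2 := ((h1.eventually (gt_mem_nhds ha)).and (lt_mem_nhds ht)).filter_mono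
    (nhdsWithin_le_nhds (s := Set.Iio t))
  obtain ⟨c, ⟨hc, hc0⟩, hc'⟩ := (h2.and self_mem_nhdsWithin).exists
  exact ⟨c, hc0, hc', hc⟩

namespace RegVarStep

variable {α : ℝ} {g : ℝ → ℝ} {ι : Type*} {l : Filter ι}

theorem tendsto_hitting_div (h : RegVarStep α g) (hα : 0 < α) {q : ι → ℝ} {m : ι → ℕ} {t : ℝ}
    (ht : 0 < t) (hm : Tendsto m l atTop) (hq : Tendsto (fun i => q i / g^[m i] 1) l (𝓝 t)) :
    Tendsto (fun i => (hitting g (q i) : ℝ) / m i) l (𝓝 (t ^ (-α))) := by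
  rw [tendsto_order]
  refine ⟨fun a ha => ?_, fun a ha => ?_⟩
  · obtain ⟨c, hc, hac⟩ := exists_gt_of_lt_rpow ht ha
    have h1 := ((h.tendsto_hitting_const_mul_orbit hα (ht.trans hc)).comp hm).eventually
      (lt_mem_nhds hac)
    filter_upwards [h1, hq.eventually (gt_mem_nhds hc), hq.eventually (lt_mem_nhds ht)]
      with i hi hi1 hi2
    have hQ := h.orbit_pos (m i)
    have hq0 : 0 < q i := by
      have := mul_pos hi2 hQ; rwa [div_mul_cancel₀ _ hQ.ne'] at this
    rw [div_lt_iff₀ hQ] at hi1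
    have h2 : (hitting g (c * g^[m i] 1) : ℝ) ≤ hitting g (q i) := by
      exact_mod_cast h.hitting_anti hq0 hi1.le
    exact hi.trans_le (by simp only [Function.comp]; gcongr)
  · obtain ⟨c, hc0, hc, hac⟩ := exists_lt_of_rpow_lt ht ha
    have h1 := ((h.tendsto_hitting_const_mul_orbit hα hc0).comp hm).eventually (gt_mem_nhds hac)
    filter_upwards [h1, hq.eventually (lt_mem_nhds hc)] with i hi hi1
    have hQ := h.orbit_pos (m i)
    rw [lt_div_iff₀ hQ] at hi1
    have h2 : (hitting g (q i) : ℝ) ≤ hitting g (c * g^[m i] 1) := by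
      exact_mod_cast h.hitting_anti (by positivity) hi1.le
    exact lt_of_le_of_lt (by simp only [Function.comp]; gcongr) hi

/-- Inverts the hitting asymptotics: `hitting g (c ^ (-1/α) Q_b) ~ c b`, so comparing `a` with this
count for `c` on either side of `t` places `Q_a` above or below `c ^ (-1/α) Q_b`. -/
theorem tendsto_orbit_div (h : RegVarStep α g) (hα : 0 < α) {a b : ι → ℕ} {t : ℝ}
    (ht : 0 < t) (hb : Tendsto b l atTop) (hab : Tendsto (fun i => (a i : ℝ) / b i) l (𝓝 t)) :
    Tendsto (fun i => g^[a i] 1 / g^[b i] 1) l (𝓝 (t ^ (-(1 / α)))) := by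
  have hinv : ∀ {c : ℝ}, 0 < c → (c ^ (-(1 / α))) ^ (-α) = c := fun hc => by
    rw [← Real.rpow_mul hc.le, neg_mul_neg, one_div_mul_cancel hα.ne', Real.rpow_one]
  rw [tendsto_order]
  refine ⟨fun x hx => ?_, fun x hx => ?_⟩
  · obtain ⟨c, hc, hxc⟩ := exists_gt_of_lt_rpow ht hx
    have hc0 := ht.trans hc
    have h1 := (h.tendsto_hitting_const_mul_orbit hα (Real.rpow_pos_of_pos hc0 (-(1 / α)))).comp hb
    rw [hinv hc0] at h1
    obtain ⟨d, htd, hdc⟩ := exists_between hc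
    filter_upwards [h1.eventually (lt_mem_nhds hdc), hab.eventually (gt_mem_nhds htd),
      hb.eventually (eventually_gt_atTop 0)] with i hi hi1 hi0
    have hQ := h.orbit_pos (b i)
    have hb0 : (0 : ℝ) < b i := by exact_mod_cast hi0
    have h3 : (a i : ℝ) < hitting g (c ^ (-(1 / α)) * g^[b i] 1) := by
      have := hi1.trans hi
      simp only [Function.comp] at this
      rwa [div_lt_div_iff_of_pos_right hb0] at this
    have h4 := (h.lt_hitting_iff (by positivity)).1 (Nat.cast_lt.1 h3)
    exact hxc.trans (by rwa [lt_div_iff₀ hQ])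
  · obtain ⟨c, hc0, hc, hxc⟩ := exists_lt_of_rpow_lt ht hx
    have h1 := (h.tendsto_hitting_const_mul_orbit hα (Real.rpow_pos_of_pos hc0 (-(1 / α)))).comp hb
    rw [hinv hc0] at h1
    obtain ⟨d, htd, hdc⟩ := exists_between hc
    filter_upwards [h1.eventually (gt_mem_nhds htd), hab.eventually (lt_mem_nhds hdc),
      hb.eventually (eventually_gt_atTop 0)] with i hi hi1 hi0
    have hQ := h.orbit_pos (b i)
    have hb0 : (0 : ℝ) < b i := by exact_mod_cast hi0
    have h3 : (hitting g (c ^ (-(1 / α)) * g^[b i] 1) : ℝ) < a i := by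
      have := hi.trans hi1
      simp only [Function.comp] at this
      rwa [div_lt_div_iff_of_pos_right hb0] at this
    have h4 := (h.hitting_le_iff (by positivity)).1 (Nat.cast_lt.1 h3).le
    exact lt_of_le_of_lt (by rwa [div_le_iff₀ hQ]) hxc

/-- The increment `Q_n - Q_{n+1}` of the orbit of `1`. -/
noncomputable def incr (g : ℝ → ℝ) (n : ℕ) : ℝ := g^[n] 1 - g^[n + 1] 1

theorem incr_eq (h : RegVarStep α g) (n : ℕ) : incr g n = g^[n] 1 * decr g (g^[n] 1) := by
  rw [incr, Function.iterate_succ_apply', eq_mul_decr g (h.orbit_pos n)]; ring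

theorem incr_pos (h : RegVarStep α g) (n : ℕ) : 0 < incr g n := by
  rw [h.incr_eq]; exact mul_pos (h.orbit_pos n) (h.decr_pos (h.orbit_pos n) (h.orbit_le_one n))

theorem incr_anti (h : RegVarStep α g) : Antitone (incr g) := by
  intro m n hmn
  rw [h.incr_eq, h.incr_eq]
  have h1 := h.strictAnti.antitone hmn
  have h2 := h.decr_mono (h.orbit_mem n) (h.orbit_mem m) h1
  exact mul_le_mul h1 h2 (h.decr_pos (h.orbit_pos n) (h.orbit_le_one n)).le (h.orbit_pos m).le

theorem orbit_sub_le (h : RegVarStep α g) (p k : ℕ) :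
    g^[p] 1 - g^[p + k] 1 ≤ k * incr g p := by
  induction k with
  | zero => simp
  | succ k ih =>
    have h1 : incr g (p + k) ≤ incr g p := h.incr_anti (Nat.le_add_right _ _)
    have h2 : g^[p] 1 - g^[p + (k + 1)] 1 = (g^[p] 1 - g^[p + k] 1) + incr g (p + k) := by
      rw [incr, add_assoc]; ring
    rw [h2]; push_cast; linarith

theorem le_orbit_sub (h : RegVarStep α g) (p k : ℕ) :
    k * incr g (p + k) ≤ g^[p] 1 - g^[p + k] 1 := by
  induction k with
  | zero => simp
  | succ k ih =>
    have h1 : incr g (p + (k + 1)) ≤ incr g (p + k) := h.incr_anti (by omega)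
    have h2 : g^[p] 1 - g^[p + (k + 1)] 1 = (g^[p] 1 - g^[p + k] 1) + incr g (p + k) := by
      rw [incr, add_assoc]; ring
    have h3 : (k : ℝ) * incr g (p + (k + 1)) ≤ k * incr g (p + k) := by gcongr
    rw [h2]; push_cast; linarith

/-- Since `Δ_n = Q_n * decr g Q_n` and `n * decr g Q_n → 1 / α`, one has `Δ_n ~ Q_n / (α n)`, and
both factors are stable under equivalent indices. -/
theorem tendsto_incr_div (h : RegVarStep α g) (hα : 0 < α) {a b : ι → ℕ}
    (ha : Tendsto a l atTop) (hb : Tendsto b l atTop)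
    (hab : Tendsto (fun i => (a i : ℝ) / b i) l (𝓝 1)) :
    Tendsto (fun i => incr g (a i) / incr g (b i)) l (𝓝 1) := by
  have h1 := h.tendsto_orbit_div hα one_pos hb hab
  have h2 := ((h.tendsto_mul_decr_orbit hα).comp ha).div
    ((h.tendsto_mul_decr_orbit hα).comp hb) (by positivity)
  have h3 := (h1.mul h2).div hab one_ne_zero
  rw [div_self (by positivity), Real.one_rpow, mul_one, div_one] at h3
  refine h3.congr' ?_
  filter_upwards [ha.eventually (eventually_gt_atTop 0), hb.eventually (eventually_gt_atTop 0)]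
    with i hi hi'
  have e1 := (h.decr_pos (h.orbit_pos (a i)) (h.orbit_le_one _)).ne'
  have e2 := (h.decr_pos (h.orbit_pos (b i)) (h.orbit_le_one _)).ne'
  have e3 := (h.orbit_pos (b i)).ne'
  rw [h.incr_eq, h.incr_eq]
  simp only [Pi.div_apply, Function.comp]
  field_simp

/-- Iterates of `g` started at `q` are squeezed between shifted orbits of `1`. -/
theorem iterate_mem_Icc (h : RegVarStep α g) (p : ℕ) {q : ℝ} (h0 : 0 < q) (h1 : q ≤ 1)
    (hN : 1 ≤ hitting g q) :
    g^[p] q ∈ Set.Icc (g^[p + hitting g q] 1) (g^[p + (hitting g q - 1)] 1) := by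
  rw [Function.iterate_add_apply, Function.iterate_add_apply]
  exact ⟨h.iterate_mono p (h.orbit_pos _) ((h.hitting_le_iff h0).1 le_rfl) h1,
    h.iterate_mono p h0 ((h.lt_hitting_iff h0).1 (by omega)).le (h.orbit_le_one _)⟩

/-- The bracket of `q` by orbit points has indices `N` and `N - 1`. As `N → ∞`, the truncated
subtraction is eventually genuine and both indices have the same asymptotics. -/
theorem tendsto_hitting_pred_div (h : RegVarStep α g) (hα : 0 < α) {q : ι → ℝ} {m : ι → ℕ}
    {t : ℝ} (ht : 0 < t) (hm : Tendsto m l atTop)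
    (hq : Tendsto (fun i => q i / g^[m i] 1) l (𝓝 t)) :
    (∀ᶠ i in l, 1 ≤ hitting g (q i)) ∧
      Tendsto (fun i => ((hitting g (q i) - 1 : ℕ) : ℝ) / m i) l (𝓝 (t ^ (-α))) := by
  have hN := h.tendsto_hitting_div hα ht hm hq
  have hmR : Tendsto (fun i => (m i : ℝ)) l atTop := tendsto_natCast_atTop_atTop.comp hm
  have hminv : Tendsto (fun i => 1 / (m i : ℝ)) l (𝓝 0) := by
    simpa [Function.comp_def] using tendsto_inv_atTop_zero.comp hmR
  have hNtop : Tendsto (fun i => (hitting g (q i) : ℝ)) l atTop := by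
    refine (hN.pos_mul_atTop (Real.rpow_pos_of_pos ht _) hmR).congr' ?_
    filter_upwards [hm.eventually (eventually_gt_atTop 0)] with i hi
    have : (m i : ℝ) ≠ 0 := by exact_mod_cast hi.ne'
    field_simp
  have hN1 : ∀ᶠ i in l, 1 ≤ hitting g (q i) := by
    filter_upwards [hNtop.eventually (eventually_ge_atTop 1)] with i hi
    exact_mod_cast hi
  refine ⟨hN1, ?_⟩
  have := hN.sub hminv
  rw [sub_zero] at this
  refine this.congr' ?_
  filter_upwards [hN1] with i hi
  rw [Nat.cast_sub hi, sub_div, Nat.cast_one]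

/-- The start `q` is about `N ~ t ^ (-α) m` steps down the orbit, so `g^[p] q` lags behind `Q_p` by
about `N` increments. Because `N = o(p)`, all of them are asymptotic to `Δ_p`. -/
theorem tendsto_orbit_sub_iterate (h : RegVarStep α g) (hα : 0 < α) {q : ι → ℝ} {m p : ι → ℕ}
    {t : ℝ} (ht : 0 < t) (hm : Tendsto m l atTop) (hp : Tendsto p l atTop)
    (hmp : Tendsto (fun i => (m i : ℝ) / p i) l (𝓝 0))
    (hq1 : ∀ i, q i ≤ 1) (hq : Tendsto (fun i => q i / g^[m i] 1) l (𝓝 t)) :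
    Tendsto (fun i => (g^[p i] 1 - g^[p i] (q i)) / (m i * incr g (p i))) l (𝓝 (t ^ (-α))) := by
  have hN := h.tendsto_hitting_div hα ht hm hq
  obtain ⟨hN1, hN'⟩ := h.tendsto_hitting_pred_div hα ht hm hq
  have hratio : Tendsto (fun i => ((p i + (hitting g (q i) - 1) : ℕ) : ℝ) / p i) l (𝓝 1) := by
    have := (hN'.mul hmp).const_add 1
    rw [mul_zero, add_zero] at this
    refine this.congr' ?_
    filter_upwards [hm.eventually (eventually_gt_atTop 0), hp.eventually (eventually_gt_atTop 0)]
      with i hi hi'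
    have e1 : (m i : ℝ) ≠ 0 := by exact_mod_cast hi.ne'
    have e2 : (p i : ℝ) ≠ 0 := by exact_mod_cast hi'.ne'
    push_cast
    field_simp
  have hΔ := h.tendsto_incr_div hα (tendsto_atTop_mono (fun i => Nat.le_add_right _ _) hp) hp hratio
  have hlow := hN'.mul hΔ
  rw [mul_one] at hlow
  refine tendsto_of_tendsto_of_tendsto_of_le_of_le' hlow hN ?_ ?_
  all_goals
    filter_upwards [hN1, hm.eventually (eventually_gt_atTop 0), hq.eventually (lt_mem_nhds ht)]
      with i hi hi' hqi
    have hQ := h.orbit_pos (m i)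
    have hq0 : 0 < q i := by
      have := mul_pos hqi hQ; rwa [div_mul_cancel₀ _ hQ.ne'] at this
    have e1 : (0 : ℝ) < m i := by exact_mod_cast hi'
    have e2 := h.incr_pos (p i)
    have h3 := h.iterate_mem_Icc (p i) hq0 (hq1 i) hi
  · have h4 := h.le_orbit_sub (p i) (hitting g (q i) - 1)
    rw [div_mul_div_comm, div_le_div_iff_of_pos_right (by positivity)]
    linarith [h3.2]
  · have h4 := h.orbit_sub_le (p i) (hitting g (q i))
    rw [← mul_div_mul_right (hitting g (q i) : ℝ) _ e2.ne',
      div_le_div_iff_of_pos_right (by positivity)]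
    linarith [h3.1]

/-- Now the lag `N ~ t ^ (-α) m` is comparable with `k`: the iterate is close to `Q_{k+N}` and `(k +
N) / k → 1 + t ^ (-α) / x`. -/
theorem tendsto_iterate_div_orbit (h : RegVarStep α g) (hα : 0 < α) {q : ι → ℝ} {m k : ι → ℕ}
    {t x : ℝ} (ht : 0 < t) (hx : 0 < x) (hm : Tendsto m l atTop) (hk : Tendsto k l atTop)
    (hkm : Tendsto (fun i => (k i : ℝ) / m i) l (𝓝 x))
    (hq1 : ∀ i, q i ≤ 1) (hq : Tendsto (fun i => q i / g^[m i] 1) l (𝓝 t)) :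
    Tendsto (fun i => g^[k i] (q i) / g^[k i] 1) l (𝓝 ((1 + t ^ (-α) / x) ^ (-(1 / α)))) := by
  have hN := h.tendsto_hitting_div hα ht hm hq
  obtain ⟨hN1, hN'⟩ := h.tendsto_hitting_pred_div hα ht hm hq
  have hpos : 0 < 1 + t ^ (-α) / x := by positivity
  have key : ∀ N : ι → ℕ, Tendsto (fun i => (N i : ℝ) / m i) l (𝓝 (t ^ (-α))) →
      Tendsto (fun i => g^[k i + N i] 1 / g^[k i] 1) l
        (𝓝 ((1 + t ^ (-α) / x) ^ (-(1 / α)))) := by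
    intro N hN
    refine h.tendsto_orbit_div hα hpos hk ?_
    have := (hN.div hkm hx.ne').const_add 1
    refine this.congr' ?_
    filter_upwards [hm.eventually (eventually_gt_atTop 0), hk.eventually (eventually_gt_atTop 0)]
      with i hi hi'
    have e1 : (m i : ℝ) ≠ 0 := by exact_mod_cast hi.ne'
    have e2 : (k i : ℝ) ≠ 0 := by exact_mod_cast hi'.ne'
    push_cast
    simp only [Pi.div_apply]
    field_simp
  refine tendsto_of_tendsto_of_tendsto_of_le_of_le' (key _ hN) (key _ hN') ?_ ?_
  all_goals
    filter_upwards [hN1, hq.eventually (lt_mem_nhds ht)] with i hi hqi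
    have hQ := h.orbit_pos (m i)
    have hq0 : 0 < q i := by
      have := mul_pos hqi hQ; rwa [div_mul_cancel₀ _ hQ.ne'] at this
    have h3 := h.iterate_mem_Icc (k i) hq0 (hq1 i) hi
    have := h.orbit_pos (k i)
  · gcongr; exact h3.1
  · gcongr; exact h3.2

end RegVarStep
-- The moment method for weighted variables in the unit interval
/-- A nonnegative weight `W` and a variable `T` with values in `[0, 1]` such that `W T` is
integrable. -/
structure UnitWeight {Ω : Type*} [MeasurableSpace Ω] (μ : Measure Ω) (W T : Ω → ℝ) : Prop where
  aemeasurable : AEMeasurable T μ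
  integrable : Integrable (fun ω => W ω * T ω) μ
  nonneg : ∀ᵐ ω ∂μ, 0 ≤ W ω
  mem : ∀ᵐ ω ∂μ, T ω ∈ Set.Icc (0 : ℝ) 1

/-- The continuous function equal to `0` up to `a`, to `1` from `b` on, and affine between. -/
noncomputable def ramp (a b t : ℝ) : ℝ := max 0 (min 1 ((t - a) / (b - a)))

theorem continuous_ramp (a b : ℝ) : Continuous (ramp a b) := by
  unfold ramp; fun_prop

theorem ramp_mem (a b t : ℝ) : ramp a b t ∈ Set.Icc (0 : ℝ) 1 :=
  ⟨le_max_left _ _, max_le zero_le_one (min_le_left _ _)⟩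

theorem ramp_eq_one {a b t : ℝ} (hab : a < b) (ht : b ≤ t) : ramp a b t = 1 := by
  have : 1 ≤ (t - a) / (b - a) := by rw [le_div_iff₀ (by linarith)]; linarith
  rw [ramp, min_eq_left this, max_eq_right zero_le_one]

theorem ramp_eq_zero {a b t : ℝ} (hab : a < b) (ht : t ≤ a) : ramp a b t = 0 := by
  have : (t - a) / (b - a) ≤ 0 := div_nonpos_of_nonpos_of_nonneg (by linarith) (by linarith)
  rw [ramp, max_eq_left ((min_le_right _ _).trans this)]

/-- The ramp divided by the identity, extended continuously. -/
noncomputable def rampDiv (a b t : ℝ) : ℝ := ramp a b t / max t a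

theorem continuous_rampDiv {a : ℝ} (ha : 0 < a) (b : ℝ) : Continuous (rampDiv a b) :=
  (continuous_ramp a b).div (continuous_id.max continuous_const)
    fun _ => (lt_max_of_lt_right ha).ne'

theorem rampDiv_mem {a b : ℝ} (ha : 0 < a) (t : ℝ) : rampDiv a b t ∈ Set.Icc (0 : ℝ) (1 / a) := by
  have h1 := ramp_mem a b t
  have h2 : 0 < max t a := lt_max_of_lt_right ha
  refine ⟨div_nonneg h1.1 h2.le, ?_⟩
  exact div_le_div₀ zero_le_one h1.2 ha (le_max_right _ _)

/-- Writes the mass of `{c ≤ T}` in the form `∫ W T φ(T)`. Only `W T`, not `W`, is assumed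
integrable, so that limits of infinite total mass are allowed. -/
theorem mul_ite_one_div {Ω : Type*} (W T : Ω → ℝ) {c : ℝ} (hc : 0 < c) (ω : Ω) :
    W ω * T ω * (if c ≤ T ω then 1 / T ω else 0) = if c ≤ T ω then W ω else 0 := by
  split_ifs with hc'
  · field_simp [(hc.trans_le hc').ne']
  · simp

namespace UnitWeight

variable {Ω : Type*} [MeasurableSpace Ω] {μ : Measure Ω} {W T : Ω → ℝ}

theorem integrable_mul_comp (h : UnitWeight μ W T) {φ : ℝ → ℝ} (hφ : Measurable φ) {B : ℝ}
    (hB : ∀ t ∈ Set.Icc (0 : ℝ) 1, |φ t| ≤ B) : Integrable (fun ω => W ω * T ω * φ (T ω)) μ := by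
  refine h.integrable.mul_bdd (c := B) (hφ.comp_aemeasurable h.aemeasurable).aestronglyMeasurable ?_
  filter_upwards [h.mem] with ω hω using hB _ hω

theorem integrable_mul_continuous (h : UnitWeight μ W T) {φ : ℝ → ℝ} (hφ : Continuous φ) :
    Integrable (fun ω => W ω * T ω * φ (T ω)) μ := by
  obtain ⟨B, hB⟩ := isCompact_Icc.exists_bound_of_continuousOn (s := Set.Icc (0 : ℝ) 1)
    hφ.continuousOn
  exact h.integrable_mul_comp hφ.measurable hB

theorem integrable_mul_pow (h : UnitWeight μ W T) (k : ℕ) :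
    Integrable (fun ω => W ω * T ω ^ (k + 1)) μ :=
  (h.integrable_mul_continuous (continuous_pow k)).congr
    (Eventually.of_forall fun ω => by simp only; ring)

theorem integral_nonneg (h : UnitWeight μ W T) {φ : ℝ → ℝ}
    (hφ : ∀ t ∈ Set.Icc (0 : ℝ) 1, 0 ≤ φ t) : 0 ≤ ∫ ω, W ω * T ω * φ (T ω) ∂μ := by
  refine integral_nonneg_of_ae ?_
  filter_upwards [h.mem, h.nonneg] with ω h1 h2
  exact mul_nonneg (mul_nonneg h2 h1.1) (hφ _ h1)

theorem integral_mono (h : UnitWeight μ W T) {φ ψ : ℝ → ℝ}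
    (hφ : Integrable (fun ω => W ω * T ω * φ (T ω)) μ)
    (hψ : Integrable (fun ω => W ω * T ω * ψ (T ω)) μ)
    (hle : ∀ t ∈ Set.Icc (0 : ℝ) 1, φ t ≤ ψ t) :
    ∫ ω, W ω * T ω * φ (T ω) ∂μ ≤ ∫ ω, W ω * T ω * ψ (T ω) ∂μ := by
  refine integral_mono_ae hφ hψ ?_
  filter_upwards [h.mem, h.nonneg] with ω h1 h2
  exact mul_le_mul_of_nonneg_left (hle _ h1) (mul_nonneg h2 h1.1)

theorem integral_mul_polynomial (h : UnitWeight μ W T) (p : Polynomial ℝ) :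
    ∫ ω, W ω * T ω * p.eval (T ω) ∂μ =
      ∑ k ∈ Finset.range (p.natDegree + 1), p.coeff k * ∫ ω, W ω * T ω ^ (k + 1) ∂μ := by
  simp_rw [← integral_const_mul]
  rw [← integral_finsetSum _ fun k _ => (h.integrable_mul_pow k).const_mul _]
  refine integral_congr_ae (Eventually.of_forall fun ω => ?_)
  simp only [Polynomial.eval_eq_sum_range, Finset.mul_sum]
  exact Finset.sum_congr rfl fun k _ => by ring

theorem abs_integral_sub_le (h : UnitWeight μ W T) {φ ψ : ℝ → ℝ} (hφ : Continuous φ)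
    (hψ : Continuous ψ) {η : ℝ} (hη : ∀ t ∈ Set.Icc (0 : ℝ) 1, |φ t - ψ t| ≤ η) :
    |∫ ω, W ω * T ω * φ (T ω) ∂μ - ∫ ω, W ω * T ω * ψ (T ω) ∂μ| ≤ η * ∫ ω, W ω * T ω ∂μ := by
  rw [← integral_sub (h.integrable_mul_continuous hφ) (h.integrable_mul_continuous hψ),
    ← integral_const_mul, ← Real.norm_eq_abs]
  refine norm_integral_le_of_norm_le (h.integrable.const_mul η) ?_
  filter_upwards [h.mem, h.nonneg] with ω h1 h2
  rw [← mul_sub, Real.norm_eq_abs, abs_mul, abs_of_nonneg (mul_nonneg h2 h1.1), mul_comm]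
  exact mul_le_mul_of_nonneg_right (hη _ h1) (mul_nonneg h2 h1.1)

theorem measurable_ite_div (c : ℝ) : Measurable fun t : ℝ => if c ≤ t then 1 / t else 0 :=
  Measurable.ite measurableSet_Ici (by fun_prop) measurable_const

theorem integrable_ite (h : UnitWeight μ W T) {c : ℝ} (hc : 0 < c) :
    Integrable (fun ω => W ω * T ω * (if c ≤ T ω then 1 / T ω else 0)) μ := by
  refine h.integrable_mul_comp (φ := fun t => if c ≤ t then 1 / t else 0) (measurable_ite_div c)
    (B := 1 / c) fun t ht => ?_
  split_ifs with h1
  · rw [abs_of_nonneg (by have := ht.1; positivity)]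
    exact one_div_le_one_div_of_le hc h1
  · simp only [abs_zero]; positivity

variable {ι : Type*} {l : Filter ι} {V S : ι → Ω → ℝ}
  {Ω' : Type*} [MeasurableSpace Ω'] {G : Measure Ω'} {W' T' : Ω' → ℝ}

/-- Convergence of all moments of positive order gives convergence of the integrals of
`t ↦ t φ(t)` for continuous `φ`. -/
theorem tendsto_integral_mul_continuous (hV : ∀ i, UnitWeight μ (V i) (S i))
    (hG : UnitWeight G W' T')
    (hmom : ∀ k : ℕ, Tendsto (fun i => ∫ ω, V i ω * S i ω ^ (k + 1) ∂μ) l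
      (𝓝 (∫ ω, W' ω * T' ω ^ (k + 1) ∂G))) {φ : ℝ → ℝ} (hφ : Continuous φ) :
    Tendsto (fun i => ∫ ω, V i ω * S i ω * φ (S i ω) ∂μ) l
      (𝓝 (∫ ω, W' ω * T' ω * φ (T' ω) ∂G)) := by
  have hmass := hmom 0
  simp only [zero_add, pow_one] at hmass
  set A := ∫ ω, W' ω * T' ω ∂G with hA
  have hA0 : 0 ≤ A := by
    have := hG.integral_nonneg (φ := fun _ => 1) (fun _ _ => zero_le_one)
    simpa using this
  rw [Metric.tendsto_nhds]
  intro ε hε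
  set η := ε / (3 * (A + 1)) with hη
  have hη0 : 0 < η := by positivity
  have hηA : η * (A + 1) = ε / 3 := by rw [hη]; field_simp
  -- Weierstrass approximation: after multiplication by `t`, a polynomial involves only moments of
  -- positive order.
  obtain ⟨p, hp⟩ := exists_polynomial_near_of_continuousOn 0 1 φ hφ.continuousOn η hη0
  have hp' : ∀ t ∈ Set.Icc (0 : ℝ) 1, |φ t - p.eval t| ≤ η := fun t ht => by
    rw [abs_sub_comm]; exact (hp t ht).le
  have hpoly : Tendsto (fun i => ∫ ω, V i ω * S i ω * p.eval (S i ω) ∂μ) l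
      (𝓝 (∫ ω, W' ω * T' ω * p.eval (T' ω) ∂G)) := by
    simp_rw [(hV _).integral_mul_polynomial, hG.integral_mul_polynomial]
    exact tendsto_finsetSum _ fun k _ => (hmom k).const_mul _
  filter_upwards [hmass.eventually (gt_mem_nhds (show A < A + 1 by linarith)),
    Metric.tendsto_nhds.1 hpoly (ε / 3) (by positivity)] with i h1 h2
  have h3 := (hV i).abs_integral_sub_le hφ p.continuous hp'
  have h4 := hG.abs_integral_sub_le hφ p.continuous hp'
  rw [Real.dist_eq] at h2 ⊢
  have h5 : η * ∫ ω, V i ω * S i ω ∂μ ≤ η * (A + 1) := by gcongr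
  have h6 : η * A < η * (A + 1) := by nlinarith
  rw [abs_lt] at h2 ⊢
  rw [abs_le] at h3 h4
  constructor <;> linarith [h3.1, h3.2, h4.1, h4.2, h2.1, h2.2]

/-- Continuous approximation of the cut from above. The offset `c / (k + 2)` keeps the lower level
at least `c / 2`, which provides the dominating constant. -/
theorem tendsto_integral_rampDiv_left (h : UnitWeight μ W T) {c : ℝ} (hc : 0 < c) :
    Tendsto (fun k : ℕ => ∫ ω, W ω * T ω * rampDiv (c - c / (k + 2)) c (T ω) ∂μ) atTop
      (𝓝 (∫ ω, W ω * T ω * (if c ≤ T ω then 1 / T ω else 0) ∂μ)) := by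
  have hck : ∀ k : ℕ, c / 2 ≤ c - c / (k + 2) ∧ c - c / (k + 2) < c := fun k => by
    have : c / ((k : ℝ) + 2) ≤ c / 2 := by gcongr; linarith [(Nat.cast_nonneg k : (0 : ℝ) ≤ k)]
    have : 0 < c / ((k : ℝ) + 2) := by positivity
    constructor <;> linarith
  refine tendsto_integral_of_dominated_convergence (fun ω => W ω * T ω * (1 / (c / 2)))
    (fun k => (h.integrable_mul_continuous
      (continuous_rampDiv (by linarith [(hck k).1]) c)).aestronglyMeasurable)
    (h.integrable.mul_const _) (fun k => ?_) ?_
  · filter_upwards [h.mem, h.nonneg] with ω h1 h2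
    have h0 : 0 < c - c / (k + 2) := by linarith [(hck k).1]
    have h3 := rampDiv_mem (b := c) h0 (T ω)
    rw [Real.norm_eq_abs, abs_of_nonneg (mul_nonneg (mul_nonneg h2 h1.1) h3.1)]
    refine mul_le_mul_of_nonneg_left (h3.2.trans ?_) (mul_nonneg h2 h1.1)
    exact one_div_le_one_div_of_le (by positivity) (hck k).1
  · filter_upwards [h.mem] with ω h1
    refine Tendsto.const_mul _ ?_
    refine tendsto_const_nhds.congr' ?_
    split_ifs with hcT
    · refine Eventually.of_forall fun k => ?_
      change 1 / T ω = rampDiv _ _ (T ω)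
      rw [rampDiv, ramp_eq_one (hck k).2 hcT, max_eq_left ((hck k).2.le.trans hcT)]
    · have hlim : Tendsto (fun k : ℕ => c - c / ((k : ℝ) + 2)) atTop (𝓝 (c - 0)) := by
        refine tendsto_const_nhds.sub (tendsto_const_nhds.div_atTop ?_)
        exact tendsto_atTop_add_const_right _ _ tendsto_natCast_atTop_atTop
      rw [sub_zero] at hlim
      filter_upwards [hlim.eventually (lt_mem_nhds (not_le.1 hcT))] with k hk
      rw [rampDiv, ramp_eq_zero (hck k).2 hk.le, zero_div]

/-- Approximation from below: these ramps vanish at `c`, so the level `c` must not be charged. -/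
theorem tendsto_integral_rampDiv_right (h : UnitWeight μ W T) {c : ℝ} (hc : 0 < c)
    (hne : ∀ᵐ ω ∂μ, T ω ≠ c) :
    Tendsto (fun k : ℕ => ∫ ω, W ω * T ω * rampDiv c (c + 1 / (k + 1)) (T ω) ∂μ) atTop
      (𝓝 (∫ ω, W ω * T ω * (if c ≤ T ω then 1 / T ω else 0) ∂μ)) := by
  have hck : ∀ k : ℕ, c < c + 1 / ((k : ℝ) + 1) := fun k => by
    have : 0 < 1 / ((k : ℝ) + 1) := by positivity
    linarith
  refine tendsto_integral_of_dominated_convergence (fun ω => W ω * T ω * (1 / c))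
    (fun k => (h.integrable_mul_continuous (continuous_rampDiv hc _)).aestronglyMeasurable)
    (h.integrable.mul_const _) (fun k => ?_) ?_
  · filter_upwards [h.mem, h.nonneg] with ω h1 h2
    have h3 := rampDiv_mem (b := c + 1 / (k + 1)) hc (T ω)
    rw [Real.norm_eq_abs, abs_of_nonneg (mul_nonneg (mul_nonneg h2 h1.1) h3.1)]
    exact mul_le_mul_of_nonneg_left h3.2 (mul_nonneg h2 h1.1)
  · filter_upwards [hne] with ω h1
    refine Tendsto.const_mul _ ?_
    refine tendsto_const_nhds.congr' ?_
    split_ifs with hcT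
    · have hlim : Tendsto (fun k : ℕ => c + 1 / ((k : ℝ) + 1)) atTop (𝓝 (c + 0)) :=
        tendsto_const_nhds.add tendsto_one_div_add_atTop_nhds_zero_nat
      rw [add_zero] at hlim
      filter_upwards [hlim.eventually (gt_mem_nhds (lt_of_le_of_ne hcT h1.symm))] with k hk
      rw [rampDiv, ramp_eq_one (hck k) hk.le, max_eq_left hcT]
    · refine Eventually.of_forall fun k => ?_
      change 0 = rampDiv _ _ (T ω)
      rw [rampDiv, ramp_eq_zero (hck k) (not_le.1 hcT).le, zero_div]

/-- Equal moments of positive order give equal masses of `{c ≤ T}`. -/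
theorem integral_ite_eq_of_moments (h : UnitWeight μ W T) (hG : UnitWeight G W' T')
    (hmom : ∀ k : ℕ, ∫ ω, W ω * T ω ^ (k + 1) ∂μ = ∫ ω, W' ω * T' ω ^ (k + 1) ∂G)
    {c : ℝ} (hc : 0 < c) :
    ∫ ω, (if c ≤ T ω then W ω else 0) ∂μ = ∫ ω, (if c ≤ T' ω then W' ω else 0) ∂G := by
  have h1 := h.tendsto_integral_rampDiv_left hc
  have h2 := hG.tendsto_integral_rampDiv_left hc
  simp_rw [mul_ite_one_div W T hc] at h1
  simp_rw [mul_ite_one_div W' T' hc] at h2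
  refine tendsto_nhds_unique h1 (h2.congr fun k => ?_)
  have hpos : 0 < c - c / ((k : ℝ) + 2) := by
    have : c / ((k : ℝ) + 2) < c :=
      div_lt_self hc (by linarith [(Nat.cast_nonneg k : (0 : ℝ) ≤ k)])
    linarith
  have := tendsto_integral_mul_continuous (l := (atTop : Filter ℕ)) (fun _ => h) hG
    (fun k => by rw [hmom k]; exact tendsto_const_nhds) (continuous_rampDiv hpos c)
  exact (tendsto_nhds_unique tendsto_const_nhds this).symm

/-- Convergence of all moments of positive order gives convergence of the masses of
`{c ≤ S i}`, if the limit does not charge the level `c`. -/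
theorem tendsto_integral_ite (hV : ∀ i, UnitWeight μ (V i) (S i)) (hG : UnitWeight G W' T')
    (hmom : ∀ k : ℕ, Tendsto (fun i => ∫ ω, V i ω * S i ω ^ (k + 1) ∂μ) l
      (𝓝 (∫ ω, W' ω * T' ω ^ (k + 1) ∂G))) {c : ℝ} (hc : 0 < c) (hne : ∀ᵐ ω ∂G, T' ω ≠ c) :
    Tendsto (fun i => ∫ ω, (if c ≤ S i ω then V i ω else 0) ∂μ) l
      (𝓝 (∫ ω, (if c ≤ T' ω then W' ω else 0) ∂G)) := by
  have h1 := hG.tendsto_integral_rampDiv_left hc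
  have h2 := hG.tendsto_integral_rampDiv_right hc hne
  simp_rw [← mul_ite_one_div (V _) (S _) hc, ← mul_ite_one_div W' T' hc]
  rw [tendsto_order]
  refine ⟨fun a ha => ?_, fun a ha => ?_⟩
  · obtain ⟨k, hk⟩ := (h2.eventually (lt_mem_nhds ha)).exists
    have h3 := tendsto_integral_mul_continuous hV hG hmom
      (continuous_rampDiv hc (c + 1 / ((k : ℝ) + 1)))
    filter_upwards [h3.eventually (lt_mem_nhds hk)] with i hi
    refine hi.trans_le ((hV i).integral_mono
      (φ := rampDiv c (c + 1 / ((k : ℝ) + 1))) (ψ := fun t => if c ≤ t then 1 / t else 0)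
      ((hV i).integrable_mul_continuous
      (continuous_rampDiv hc _)) ((hV i).integrable_ite hc) fun t ht => ?_)
    have hck : c < c + 1 / ((k : ℝ) + 1) := by
      have : 0 < 1 / ((k : ℝ) + 1) := by positivity
      linarith
    split_ifs with hct
    · rw [rampDiv, max_eq_left hct]
      have := (ramp_mem c (c + 1 / ((k : ℝ) + 1)) t).2
      have := hc.trans_le hct
      gcongr
    · rw [rampDiv, ramp_eq_zero hck (not_le.1 hct).le, zero_div]
  · obtain ⟨k, hk⟩ := (h1.eventually (gt_mem_nhds ha)).exists
    have hpos : 0 < c - c / ((k : ℝ) + 2) := by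
      have : c / ((k : ℝ) + 2) < c :=
        div_lt_self hc (by linarith [(Nat.cast_nonneg k : (0 : ℝ) ≤ k)])
      linarith
    have hlt : c - c / ((k : ℝ) + 2) < c := by
      have : 0 < c / ((k : ℝ) + 2) := by positivity
      linarith
    have h3 := tendsto_integral_mul_continuous hV hG hmom (continuous_rampDiv hpos c)
    filter_upwards [h3.eventually (gt_mem_nhds hk)] with i hi
    refine lt_of_le_of_lt ((hV i).integral_mono (φ := fun t => if c ≤ t then 1 / t else 0)
      (ψ := rampDiv (c - c / ((k : ℝ) + 2)) c) ((hV i).integrable_ite hc)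
      ((hV i).integrable_mul_continuous (continuous_rampDiv hpos _)) fun t ht => ?_) hi
    split_ifs with hct
    · rw [rampDiv, max_eq_left (hlt.le.trans hct), ramp_eq_one hlt hct]
    · exact (rampDiv_mem hpos t).1

end UnitWeight

/-- The tent of height one and half-width `1 / k` centred at `c`. -/
noncomputable def tent (c : ℝ) (k : ℕ) (t : ℝ) : ℝ := max 0 (1 - k * |t - c|)

theorem continuous_tent (c : ℝ) (k : ℕ) : Continuous (tent c k) := by
  unfold tent; fun_prop

theorem tent_mem (c : ℝ) (k : ℕ) (t : ℝ) : tent c k t ∈ Set.Icc (0 : ℝ) 1 :=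
  ⟨le_max_left _ _, max_le zero_le_one (by
    have : 0 ≤ (k : ℝ) * |t - c| := by positivity
    linarith)⟩

theorem tendsto_tent (c t : ℝ) :
    Tendsto (fun k => tent c k t) atTop (𝓝 (if t = c then 1 else 0)) := by
  refine tendsto_const_nhds.congr' ?_
  split_ifs with htc
  · refine Eventually.of_forall fun k => ?_
    simp [tent, htc]
  · have h1 : 0 < |t - c| := abs_pos.2 (sub_ne_zero.2 htc)
    obtain ⟨K, hK⟩ := exists_nat_gt (1 / |t - c|)
    filter_upwards [eventually_ge_atTop K] with k hk
    have : 1 / |t - c| < k := hK.trans_le (by exact_mod_cast hk)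
    rw [div_lt_iff₀ h1] at this
    rw [tent, max_eq_left (by linarith)]

theorem UnitWeight.tendsto_integral_tent {Ω : Type*} [MeasurableSpace Ω] {μ : Measure Ω}
    {W T : Ω → ℝ} (h : UnitWeight μ W T) (c : ℝ) :
    Tendsto (fun k => ∫ ω, W ω * T ω * tent c k (T ω) ∂μ) atTop
      (𝓝 (∫ ω, W ω * T ω * (if T ω = c then 1 else 0) ∂μ)) := by
  refine tendsto_integral_of_dominated_convergence (fun ω => W ω * T ω)
    (fun k => (h.integrable_mul_continuous (continuous_tent c k)).aestronglyMeasurable)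
    h.integrable (fun k => ?_)
    (Eventually.of_forall fun ω => (tendsto_tent c (T ω)).const_mul _)
  filter_upwards [h.mem, h.nonneg] with ω h1 h2
  have h3 := tent_mem c k (T ω)
  have h4 := mul_nonneg h2 h1.1
  rw [Real.norm_eq_abs, abs_of_nonneg (mul_nonneg h4 h3.1)]
  exact mul_le_of_le_one_right h4 h3.2

namespace UnitWeight

variable {Ω : Type*} [MeasurableSpace Ω] {μ : Measure Ω} {ι : Type*} {l : Filter ι}
  {V S : ι → Ω → ℝ} {Ω' : Type*} [MeasurableSpace Ω'] {G : Measure Ω'} {W' T' : Ω' → ℝ}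

/-- If the weights `V i` are dominated by weights `U i` whose limit does not charge the
level `c`, then the limit of the `V i` does not charge it either. -/
theorem ae_ne_of_le {U : ι → Ω → ℝ} {Ω'' : Type*} [MeasurableSpace Ω''] {H : Measure Ω''}
    {W'' T'' : Ω'' → ℝ} [l.NeBot] (hV : ∀ i, UnitWeight μ (V i) (S i))
    (hU : ∀ i, UnitWeight μ (U i) (S i)) (hle : ∀ᶠ i in l, ∀ ω, V i ω ≤ U i ω)
    (hH : UnitWeight H W'' T'') (hG : UnitWeight G W' T')
    (hVmom : ∀ k : ℕ, Tendsto (fun i => ∫ ω, V i ω * S i ω ^ (k + 1) ∂μ) l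
      (𝓝 (∫ ω, W'' ω * T'' ω ^ (k + 1) ∂H)))
    (hUmom : ∀ k : ℕ, Tendsto (fun i => ∫ ω, U i ω * S i ω ^ (k + 1) ∂μ) l
      (𝓝 (∫ ω, W' ω * T' ω ^ (k + 1) ∂G)))
    {c : ℝ} (hc : 0 < c) (hne : ∀ᵐ ω ∂G, T' ω ≠ c) (hpos : ∀ᵐ ω ∂H, 0 < W'' ω) :
    ∀ᵐ ω ∂H, T'' ω ≠ c := by
  -- Domination passes to the limit when tested on continuous tents; shrinking the tents then
  -- compares the masses at `c`.
  have hcomp : ∀ k, ∫ ω, W'' ω * T'' ω * tent c k (T'' ω) ∂H ≤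
      ∫ ω, W' ω * T' ω * tent c k (T' ω) ∂G := by
    intro k
    refine le_of_tendsto_of_tendsto
      (tendsto_integral_mul_continuous hV hH hVmom (continuous_tent c k))
      (tendsto_integral_mul_continuous hU hG hUmom (continuous_tent c k)) ?_
    filter_upwards [hle] with i hi
    refine integral_mono_ae ((hV i).integrable_mul_continuous (continuous_tent c k))
      ((hU i).integrable_mul_continuous (continuous_tent c k)) ?_
    filter_upwards [(hV i).mem] with ω h1
    exact mul_le_mul_of_nonneg_right (mul_le_mul_of_nonneg_right (hi ω) h1.1) (tent_mem c k _).1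
  have hzero : ∫ ω, W' ω * T' ω * (if T' ω = c then 1 else 0) ∂G = 0 := by
    refine integral_eq_zero_of_ae ?_
    filter_upwards [hne] with ω h1
    simp [h1]
  have hle0 : ∫ ω, W'' ω * T'' ω * (if T'' ω = c then 1 else 0) ∂H ≤ 0 := by
    refine le_trans ?_ hzero.le
    exact le_of_tendsto_of_tendsto' (hH.tendsto_integral_tent c)
      (hG.tendsto_integral_tent c) hcomp
  have hnn : 0 ≤ᵐ[H] fun ω => W'' ω * T'' ω * (if T'' ω = c then 1 else 0) := by
    filter_upwards [hH.mem, hH.nonneg] with ω h1 h2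
    exact mul_nonneg (mul_nonneg h2 h1.1) (by split_ifs <;> norm_num)
  have hint : Integrable (fun ω => W'' ω * T'' ω * (if T'' ω = c then 1 else 0)) H :=
    hH.integrable_mul_comp (φ := fun t => if t = c then 1 else 0)
      (Measurable.ite (measurableSet_singleton c) measurable_const measurable_const) (B := 1)
      fun t _ => by split_ifs <;> norm_num
  have h0 := (integral_eq_zero_iff_of_nonneg_ae hnn hint).1 (le_antisymm hle0
    (integral_nonneg_of_ae hnn))
  filter_upwards [h0, hpos] with ω h1 h2 h3
  simp [h3, h2.ne', hc.ne'] at h1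

end UnitWeight
-- Decomposition of the family tree at the root
/-- Offspring numbers in the subtree of the `i`-th child of the root. -/
def subtree (c : List ℕ → ℕ) (i : ℕ) : List ℕ → ℕ := fun u => c (u ++ [i])

theorem mem_generation_succ {c : List ℕ → ℕ} {n : ℕ} {w : List ℕ} :
    w ∈ generation c (n + 1) ↔ ∃ u ∈ generation c n, ∃ i < c u, i :: u = w := by
  simp [generation]

/-- Words grow at the head, so the last letter records the first-generation ancestor. Stripping it
turns the recursion at the leaves into one at the root. -/
theorem mem_generation_succ_iff_subtree {c : List ℕ → ℕ} {n : ℕ} {w : List ℕ} :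
    w ∈ generation c (n + 1) ↔
      ∃ i < c [], ∃ v ∈ generation (subtree c i) n, v ++ [i] = w := by
  induction n generalizing w with
  | zero => simp [generation]
  | succ n ih =>
    rw [mem_generation_succ]
    constructor
    · rintro ⟨u, hu, k, hk, rfl⟩
      obtain ⟨i, hi, v, hv, rfl⟩ := ih.1 hu
      exact ⟨i, hi, k :: v, mem_generation_succ.2 ⟨v, hv, k, hk, rfl⟩, rfl⟩
    · rintro ⟨i, hi, v', hv', rfl⟩
      obtain ⟨v, hv, k, hk, rfl⟩ := mem_generation_succ.1 hv'
      exact ⟨v ++ [i], ih.2 ⟨i, hi, v, hv, rfl⟩, k, hk, rfl⟩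

theorem card_biUnion_image_append (s : Finset ℕ) (A : ℕ → Finset (List ℕ)) :
    (s.biUnion fun i => (A i).image fun v => v ++ [i]).card = ∑ i ∈ s, (A i).card := by
  rw [Finset.card_biUnion]
  · refine Finset.sum_congr rfl fun i _ => Finset.card_image_of_injective _ ?_
    exact fun v w h => List.append_cancel_right h
  · intro i _ j _ hij
    refine Finset.disjoint_left.2 fun w hw hw' => ?_
    obtain ⟨v, -, rfl⟩ := Finset.mem_image.1 hw
    obtain ⟨v', -, h⟩ := Finset.mem_image.1 hw'
    have := (List.append_inj' h rfl).2
    simp at this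
    exact hij this.symm

theorem popSize_zero (c : List ℕ → ℕ) : popSize c 0 = 1 := by simp [popSize, generation]

theorem popSize_succ (c : List ℕ → ℕ) (n : ℕ) :
    popSize c (n + 1) = ∑ i ∈ Finset.range (c []), popSize (subtree c i) n := by
  have : generation c (n + 1) = (Finset.range (c [])).biUnion
      fun i => (generation (subtree c i) n).image fun v => v ++ [i] := by
    ext w
    rw [mem_generation_succ_iff_subtree]
    simp
  rw [popSize, this, card_biUnion_image_append]
  rfl

theorem reducedSize_zero (c : List ℕ → ℕ) (n : ℕ) :
    reducedSize c 0 n = if popSize c n = 0 then 0 else 1 := by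
  rw [reducedSize, popSize]
  split_ifs with h
  · simp [Finset.card_eq_zero.1 h]
  · obtain ⟨v, hv⟩ := Finset.nonempty_iff_ne_empty.2 (mt Finset.card_eq_zero.2 h)
    have : (generation c 0).filter (fun u => ∃ v ∈ generation c n, u <:+ v) = {[]} := by
      ext u
      simp only [generation, Finset.mem_filter, Finset.mem_singleton]
      exact ⟨fun h => h.1, fun h => ⟨h, v, hv, h ▸ List.nil_suffix⟩⟩
    rw [this, Finset.card_singleton]

/-- A particle of positive generation and its descendant have the same last letter, hence lie in the
same first-generation subtree; stripping that letter preserves the suffix relation. -/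
theorem reducedSize_succ (c : List ℕ → ℕ) (m n : ℕ) :
    reducedSize c (m + 1) (n + 1) =
      ∑ i ∈ Finset.range (c []), reducedSize (subtree c i) m n := by
  simp only [reducedSize]
  rw [← card_biUnion_image_append]
  congr 1
  ext w
  simp only [Finset.mem_filter, Finset.mem_biUnion, Finset.mem_range, Finset.mem_image]
  constructor
  · rintro ⟨hw, v, hv, hwv⟩
    obtain ⟨i, hi, w', hw', rfl⟩ := mem_generation_succ_iff_subtree.1 hw
    obtain ⟨j, hj, v', hv', rfl⟩ := mem_generation_succ_iff_subtree.1 hv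
    obtain ⟨t, ht⟩ := hwv
    rw [← List.append_assoc] at ht
    obtain ⟨h1, h2⟩ := List.append_inj' ht rfl
    obtain rfl : i = j := by simpa using h2
    exact ⟨i, hi, w', ⟨hw', v', hv', t, h1⟩, rfl⟩
  · rintro ⟨i, hi, w', ⟨hw', v', hv', t, h1⟩, rfl⟩
    refine ⟨mem_generation_succ_iff_subtree.2 ⟨i, hi, w', hw', rfl⟩, v' ++ [i],
      mem_generation_succ_iff_subtree.2 ⟨i, hi, v', hv', rfl⟩, t, ?_⟩
    rw [← List.append_assoc, h1]

/-- The product of `ψ` over the subtrees of the particles of generation `m`. -/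
def treeProd (ψ : (List ℕ → ℕ) → ℝ) : ℕ → (List ℕ → ℕ) → ℝ
  | 0, c => ψ c
  | m + 1, c => ∏ i ∈ Finset.range (c []), treeProd ψ m (subtree c i)

theorem measurable_subtree (i : ℕ) : Measurable fun c : List ℕ → ℕ => subtree c i :=
  measurable_pi_lambda _ fun _ => measurable_pi_apply _

theorem measurable_root_prodMk : Measurable fun c : List ℕ → ℕ => (c [], c) :=
  Measurable.prodMk (f := fun c : List ℕ → ℕ => c []) (g := fun c => c)
    (measurable_pi_apply []) measurable_id

theorem measurable_treeProd {ψ : (List ℕ → ℕ) → ℝ} (hψ : Measurable ψ) (m : ℕ) :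
    Measurable (treeProd ψ m) := by
  induction m with
  | zero => exact hψ
  | succ m ih =>
    -- The number of factors is itself random; separating it as a countable coordinate reduces to
    -- products of fixed length.
    have h1 : Measurable fun p : ℕ × (List ℕ → ℕ) =>
        ∏ i ∈ Finset.range p.1, treeProd ψ m (subtree p.2 i) :=
      measurable_from_prod_countable_right fun r =>
        Finset.measurable_fun_prod (Finset.range r) fun i _ => ih.comp (measurable_subtree i)
    exact h1.comp measurable_root_prodMk

theorem treeProd_mem {ψ : (List ℕ → ℕ) → ℝ} (hψ : ∀ c, ψ c ∈ Set.Icc (0 : ℝ) 1) (m : ℕ)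
    (c : List ℕ → ℕ) : treeProd ψ m c ∈ Set.Icc (0 : ℝ) 1 := by
  induction m generalizing c with
  | zero => exact hψ c
  | succ m ih =>
    exact ⟨Finset.prod_nonneg fun i _ => (ih _).1,
      Finset.prod_le_one (fun i _ => (ih _).1) fun i _ => (ih _).2⟩

theorem treeProd_const (s : ℝ) (n : ℕ) (c : List ℕ → ℕ) :
    treeProd (fun _ => s) n c = s ^ popSize c n := by
  induction n generalizing c with
  | zero => simp [treeProd, popSize_zero]
  | succ n ih => simp only [treeProd, ih, popSize_succ, Finset.prod_pow_eq_pow_sum]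

/-- Both sizes are sums over the subtrees rooted in generation `m`, so the exponentials multiply;
within one subtree `reducedSize c 0 k` is the indicator of survival. -/
theorem treeProd_pow_popSize_mul (s t : ℝ) (m k : ℕ) (c : List ℕ → ℕ) :
    treeProd (fun c => s ^ popSize c k * t ^ reducedSize c 0 k) m c =
      s ^ popSize c (m + k) * t ^ reducedSize c m (m + k) := by
  induction m generalizing c with
  | zero => simp [treeProd]
  | succ m ih =>
    rw [show m + 1 + k = (m + k) + 1 by ring]
    simp only [treeProd, ih, popSize_succ, reducedSize_succ, Finset.prod_mul_distrib,
      Finset.prod_pow_eq_pow_sum]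

theorem measurable_popSize (n : ℕ) : Measurable fun c => popSize c n := by
  induction n with
  | zero => simp only [popSize_zero]; exact measurable_const
  | succ n ih =>
    have h1 : Measurable fun p : ℕ × (List ℕ → ℕ) =>
        ∑ i ∈ Finset.range p.1, popSize (subtree p.2 i) n :=
      measurable_from_prod_countable_right fun r =>
        Finset.measurable_fun_sum (Finset.range r) fun i _ => ih.comp (measurable_subtree i)
    simp only [popSize_succ]
    exact h1.comp measurable_root_prodMk

theorem reducedSize_succ_zero (c : List ℕ → ℕ) (m : ℕ) : reducedSize c (m + 1) 0 = 0 := by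
  rw [reducedSize, Finset.card_eq_zero, Finset.filter_eq_empty_iff]
  intro w hw
  obtain ⟨u, -, i, -, rfl⟩ := mem_generation_succ.1 hw
  simp [generation]

theorem measurable_reducedSize (m n : ℕ) : Measurable fun c => reducedSize c m n := by
  induction m generalizing n with
  | zero =>
    simp only [reducedSize_zero]
    exact Measurable.ite (measurable_popSize n (measurableSet_singleton 0)) measurable_const
      measurable_const
  | succ m ih =>
    cases n with
    | zero => simp only [reducedSize_succ_zero]; exact measurable_const
    | succ n =>
      have h1 : Measurable fun p : ℕ × (List ℕ → ℕ) =>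
          ∑ i ∈ Finset.range p.1, reducedSize (subtree p.2 i) m n :=
        measurable_from_prod_countable_right fun r =>
          Finset.measurable_fun_sum (Finset.range r) fun i _ => (ih n).comp (measurable_subtree i)
      have h2 := h1.comp measurable_root_prodMk
      refine (congrArg Measurable (funext fun c => ?_)).mpr h2
      exact reducedSize_succ c m n

theorem reducedSize_eq_zero_iff (c : List ℕ → ℕ) (m k : ℕ) :
    reducedSize c m (m + k) = 0 ↔ popSize c (m + k) = 0 := by
  induction m generalizing c with
  | zero => rw [reducedSize_zero, zero_add]; split_ifs with h <;> simp [h]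
  | succ m ih =>
    rw [show m + 1 + k = (m + k) + 1 by ring]
    simp [reducedSize_succ, popSize_succ, ih]

/-! ### Independence of subtrees and generating functions -/

theorem measurable_iSup_comap {Ω : Type*} {ξ : List ℕ → Ω → ℕ} {A : Set (List ℕ)}
    {u : List ℕ} (hu : u ∈ A) :
    Measurable[⨆ u ∈ A, MeasurableSpace.comap (ξ u) inferInstance] (ξ u) :=
  (comap_measurable (ξ u)).mono (le_iSup₂_of_le u hu le_rfl) le_rfl

theorem measurable_subtree_iSup {Ω : Type*} {ξ : List ℕ → Ω → ℕ} {A : Set (List ℕ)}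
    {i : ℕ} (hA : ∀ u, u ++ [i] ∈ A)
    {F : (List ℕ → ℕ) → ℝ} (hF : Measurable F) :
    Measurable[⨆ u ∈ A, MeasurableSpace.comap (ξ u) inferInstance]
      fun ω => F fun u => ξ (u ++ [i]) ω :=
  hF.comp (@measurable_pi_lambda _ _ _ (_) _ _ fun u => measurable_iSup_comap (hA u))

namespace IsOffspringFamily

variable {Ω : Type*} [MeasurableSpace Ω] {P : Measure Ω} {ν : Measure ℕ} {ξ : List ℕ → Ω → ℕ}

theorem subtree (hξ : IsOffspringFamily P ν ξ) (i : ℕ) :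
    IsOffspringFamily P ν fun u => ξ (u ++ [i]) where
  measurable _ := hξ.measurable _
  law _ := hξ.law _
  indep := hξ.indep.precomp fun _ _ h => List.append_cancel_right h

theorem measurable_family (hξ : IsOffspringFamily P ν ξ) : Measurable fun ω u => ξ u ω :=
  measurable_pi_lambda _ hξ.measurable

theorem indepFun_of_disjoint (hξ : IsOffspringFamily P ν ξ) {A B : Set (List ℕ)}
    (hAB : Disjoint A B) {β γ : Type*} [MeasurableSpace β] [MeasurableSpace γ] {X : Ω → β}
    {Y : Ω → γ} (hX : Measurable[⨆ u ∈ A, MeasurableSpace.comap (ξ u) inferInstance] X)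
    (hY : Measurable[⨆ u ∈ B, MeasurableSpace.comap (ξ u) inferInstance] Y) : IndepFun X Y P := by
  have h := indep_iSup_of_disjoint (fun u => (hξ.measurable u).comap_le) hξ.indep hAB
  rw [IndepFun_iff_Indep]
  exact indep_of_indep_of_le_left (indep_of_indep_of_le_right h hY.comap_le) hX.comap_le

/-- Subtrees of different children read disjoint sets of labels, hence are independent. -/
theorem integral_prod_range (hξ : IsOffspringFamily P ν ξ) [IsProbabilityMeasure P]
    {F : (List ℕ → ℕ) → ℝ} (hF : Measurable F) {y : ℝ}
    (hy : ∀ i, ∫ ω, F (fun u => ξ (u ++ [i]) ω) ∂P = y) (r : ℕ) :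
    ∫ ω, ∏ i ∈ Finset.range r, F (fun u => ξ (u ++ [i]) ω) ∂P = y ^ r := by
  induction r with
  | zero => simp
  | succ r ih =>
    set A : Set (List ℕ) := {w | ∃ i < r, ∃ u, u ++ [i] = w} with hA
    set B : Set (List ℕ) := {w | ∃ u, u ++ [r] = w} with hB
    have hAB : Disjoint A B := by
      rw [Set.disjoint_left]
      rintro _ ⟨i, hi, u, rfl⟩ ⟨v, hv⟩
      have := (List.append_inj' hv rfl).2
      simp at this
      omega
    have h1 : Measurable[⨆ u ∈ A, MeasurableSpace.comap (ξ u) inferInstance]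
        fun ω => ∏ i ∈ Finset.range r, F fun u => ξ (u ++ [i]) ω :=
      @Finset.measurable_fun_prod _ _ _ _ _ _ (_) _ _ fun i hi =>
        measurable_subtree_iSup (A := A) (fun u => ⟨i, Finset.mem_range.1 hi, u, rfl⟩) hF
    have h2 := hξ.indepFun_of_disjoint hAB h1
      (measurable_subtree_iSup (A := B) (i := r) (fun u => ⟨u, rfl⟩) hF)
    simp_rw [Finset.prod_range_succ]
    have hm : ∀ i, Measurable fun ω => F fun u => ξ (u ++ [i]) ω := fun i =>
      hF.comp (hξ.subtree i).measurable_family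
    rw [h2.integral_fun_mul_eq_mul_integral
      (Finset.measurable_fun_prod _ fun i _ => hm i).aestronglyMeasurable
      (hm r).aestronglyMeasurable, ih, hy, pow_succ]

theorem integral_prod_range_root (hξ : IsOffspringFamily P ν ξ) [IsProbabilityMeasure P]
    {F : (List ℕ → ℕ) → ℝ} (hF : Measurable F) (hF1 : ∀ c, F c ∈ Set.Icc (0 : ℝ) 1) {y : ℝ}
    (hy : ∀ i, ∫ ω, F (fun u => ξ (u ++ [i]) ω) ∂P = y) :
    ∫ ω, ∏ i ∈ Finset.range (ξ [] ω), F (fun u => ξ (u ++ [i]) ω) ∂P = genFun ν y := by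
  have hm : ∀ i, Measurable fun ω => F fun u => ξ (u ++ [i]) ω := fun i =>
    hF.comp (hξ.subtree i).measurable_family
  set Y : Ω → ℕ → ℝ := fun ω i => F fun u => ξ (u ++ [i]) ω with hY
  have hYm : Measurable Y := measurable_pi_lambda _ hm
  have hind : IndepFun (ξ []) Y P := by
    refine hξ.indepFun_of_disjoint (A := {[]}) (B := {w | ∃ i, ∃ u, u ++ [i] = w}) ?_
      (measurable_iSup_comap rfl)
      (@measurable_pi_lambda _ _ _ (_) _ _ fun i =>
        measurable_subtree_iSup (A := {w | ∃ i, ∃ u, u ++ [i] = w})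
          (fun u => ⟨i, u, rfl⟩) hF)
    rw [Set.disjoint_left]
    rintro _ rfl ⟨i, u, hu⟩
    simp at hu
  -- Clipping to `[0, 1]` makes the product bounded on the whole space, as Fubini requires; on the
  -- values taken by `Y` it changes nothing.
  set H : ℕ × (ℕ → ℝ) → ℝ := fun p => ∏ i ∈ Finset.range p.1, max 0 (min 1 (p.2 i)) with hH
  have hHm : Measurable H := measurable_from_prod_countable_right fun r =>
    Finset.measurable_fun_prod (Finset.range r) fun i _ =>
      measurable_const.max (measurable_const.min (measurable_pi_apply i))
  have hH1 : ∀ p, ‖H p‖ ≤ 1 := fun p => by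
    rw [Real.norm_eq_abs, abs_of_nonneg (Finset.prod_nonneg fun i _ => le_max_left _ _)]
    exact Finset.prod_le_one (fun i _ => le_max_left _ _)
      fun i _ => max_le zero_le_one (min_le_left _ _)
  have hclip : ∀ ω i, max 0 (min 1 (Y ω i)) = Y ω i := fun ω i => by
    rw [min_eq_right (hF1 _).2, max_eq_right (hF1 _).1]
  have : IsProbabilityMeasure (P.map Y) := Measure.isProbabilityMeasure_map hYm.aemeasurable
  have : IsProbabilityMeasure ν := by
    rw [← hξ.law []]; exact Measure.isProbabilityMeasure_map (hξ.measurable []).aemeasurable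
  calc ∫ ω, ∏ i ∈ Finset.range (ξ [] ω), F (fun u => ξ (u ++ [i]) ω) ∂P
      = ∫ ω, H (ξ [] ω, Y ω) ∂P := by
        refine integral_congr_ae (Eventually.of_forall fun ω => ?_)
        simp only [hH, hclip]; rfl
    _ = ∫ p, H p ∂(ν.prod (P.map Y)) := by
        rw [← hξ.law [], ← (indepFun_iff_map_prod_eq_prod_map_map
          (hξ.measurable []).aemeasurable hYm.aemeasurable).1 hind,
          integral_map ((hξ.measurable []).prodMk hYm).aemeasurable hHm.aestronglyMeasurable]
    _ = ∫ k, ∫ z, H (k, z) ∂(P.map Y) ∂ν := by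
        refine integral_prod _ ?_
        exact Integrable.of_bound hHm.aestronglyMeasurable 1 (Eventually.of_forall hH1)
    _ = ∫ k, y ^ k ∂ν := by
        refine integral_congr_ae (Eventually.of_forall fun k => ?_)
        simp only
        have hHk : Measurable fun z => H (k, z) := hHm.comp measurable_prodMk_left
        rw [integral_map hYm.aemeasurable hHk.aestronglyMeasurable,
          ← hξ.integral_prod_range hF hy k]
        simp only [hH, hclip]
        rfl

/-- Each generation contributes one application of the generating function. The value `y` is
required for all offspring families because the induction moves to the families of subtrees. -/
theorem integral_treeProd [IsProbabilityMeasure P] {ψ : (List ℕ → ℕ) → ℝ} (hψ : Measurable ψ)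
    (hψ1 : ∀ c, ψ c ∈ Set.Icc (0 : ℝ) 1) {y : ℝ}
    (hy : ∀ ξ : List ℕ → Ω → ℕ, IsOffspringFamily P ν ξ → ∫ ω, ψ (fun u => ξ u ω) ∂P = y)
    (m : ℕ) (hξ : IsOffspringFamily P ν ξ) :
    ∫ ω, treeProd ψ m (fun u => ξ u ω) ∂P = (genFun ν)^[m] y := by
  induction m generalizing ξ with
  | zero => exact hy ξ hξ
  | succ m ih =>
    rw [Function.iterate_succ_apply']
    exact hξ.integral_prod_range_root (measurable_treeProd hψ m) (treeProd_mem hψ1 m)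
      fun i => ih (hξ.subtree i)

theorem integral_pow_popSize [IsProbabilityMeasure P] (hξ : IsOffspringFamily P ν ξ) {s : ℝ}
    (hs : s ∈ Set.Icc (0 : ℝ) 1) (n : ℕ) :
    ∫ ω, s ^ popSize (fun u => ξ u ω) n ∂P = (genFun ν)^[n] s := by
  have := integral_treeProd (P := P) (ν := ν) (ψ := fun _ => s) measurable_const (fun _ => hs)
    (y := s) (fun _ _ => by simp) n hξ
  simpa only [treeProd_const] using this

/-- Joint generating function of `Z(m + k)` and `Z(m, m + k)`. -/
theorem integral_pow_popSize_mul_pow_reducedSize [IsProbabilityMeasure P]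
    (hξ : IsOffspringFamily P ν ξ) {s t : ℝ} (hs : s ∈ Set.Icc (0 : ℝ) 1)
    (ht : t ∈ Set.Icc (0 : ℝ) 1) (m k : ℕ) :
    ∫ ω, s ^ popSize (fun u => ξ u ω) (m + k) *
        t ^ reducedSize (fun u => ξ u ω) m (m + k) ∂P =
      (genFun ν)^[m] ((genFun ν)^[k] 0 + t * ((genFun ν)^[k] s - (genFun ν)^[k] 0)) := by
  have hpop : ∀ {ξ : List ℕ → Ω → ℕ}, IsOffspringFamily P ν ξ → ∀ {r : ℝ}, r ∈ Set.Icc (0 : ℝ) 1 →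
      Integrable (fun ω => r ^ popSize (fun u => ξ u ω) k) P := fun {ξ} hξ {r} hr => by
    refine Integrable.of_bound (Measurable.aestronglyMeasurable ?_) 1
      (Eventually.of_forall fun ω => ?_)
    · exact (measurable_from_nat (f := fun j => r ^ j)).comp
        ((measurable_popSize k).comp hξ.measurable_family)
    · rw [Real.norm_eq_abs, abs_of_nonneg (pow_nonneg hr.1 _)]
      exact pow_le_one₀ hr.1 hr.2
  have h0 : (0 : ℝ) ∈ Set.Icc (0 : ℝ) 1 := ⟨le_rfl, zero_le_one⟩
  -- Since `Z(0, k)` is the indicator of `Z(k) > 0` and `0 ^ 0 = 1`, the joint power is a mixture of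
  -- the powers with bases `0` and `s`.
  have key : ∀ c : List ℕ → ℕ, s ^ popSize c k * t ^ reducedSize c 0 k =
      (1 - t) * 0 ^ popSize c k + t * s ^ popSize c k := fun c => by
    rw [reducedSize_zero]
    split_ifs with h
    · simp [h]
    · simp [h, mul_comm]
  have := integral_treeProd (P := P) (ν := ν)
    (ψ := fun c => s ^ popSize c k * t ^ reducedSize c 0 k) ?_ (fun c => ?_)
    (y := (genFun ν)^[k] 0 + t * ((genFun ν)^[k] s - (genFun ν)^[k] 0)) ?_ m hξ
  · simpa only [treeProd_pow_popSize_mul] using this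
  · exact ((measurable_from_nat (f := fun j => s ^ j)).comp (measurable_popSize k)).mul
      ((measurable_from_nat (f := fun j => t ^ j)).comp
        (measurable_reducedSize 0 k))
  · exact ⟨mul_nonneg (pow_nonneg hs.1 _) (pow_nonneg ht.1 _),
      mul_le_one₀ (pow_le_one₀ hs.1 hs.2) (pow_nonneg ht.1 _) (pow_le_one₀ ht.1 ht.2)⟩
  · intro ξ hξ
    simp only [key]
    rw [integral_add ((hpop hξ h0).const_mul _) ((hpop hξ hs).const_mul _), integral_const_mul,
      integral_const_mul, hξ.integral_pow_popSize h0, hξ.integral_pow_popSize hs]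
    ring

end IsOffspringFamily
-- The survival map is a regularly varying step
/-- The generating function in the coordinate `q = 1 - s`. -/
noncomputable def survival (ν : Measure ℕ) (q : ℝ) : ℝ := 1 - genFun ν (1 - q)

theorem survival_iterate (ν : Measure ℕ) (n : ℕ) (q : ℝ) :
    (survival ν)^[n] q = 1 - (genFun ν)^[n] (1 - q) := by
  induction n with
  | zero => simp
  | succ n ih =>
    rw [Function.iterate_succ_apply', Function.iterate_succ_apply', ih, survival, sub_sub_cancel]

theorem genFun_iterate (ν : Measure ℕ) (n : ℕ) (s : ℝ) :
    (genFun ν)^[n] s = 1 - (survival ν)^[n] (1 - s) := by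
  rw [survival_iterate, sub_sub_cancel, sub_sub_cancel]

section

variable {ν : Measure ℕ} [IsProbabilityMeasure ν]

theorem integrable_pow {s : ℝ} (hs : s ∈ Set.Icc (0 : ℝ) 1) :
    Integrable (fun k : ℕ => s ^ k) ν := by
  refine Integrable.of_bound measurable_from_nat.aestronglyMeasurable 1
    (Eventually.of_forall fun k => ?_)
  rw [Real.norm_eq_abs, abs_of_nonneg (pow_nonneg hs.1 _)]
  exact pow_le_one₀ hs.1 hs.2

theorem survival_eq_integral {q : ℝ} (hq : q ∈ Set.Icc (0 : ℝ) 1) :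
    survival ν q = ∫ k, (1 - (1 - q) ^ k) ∂ν := by
  have : (1 - q) ∈ Set.Icc (0 : ℝ) 1 := ⟨by linarith [hq.2], by linarith [hq.1]⟩
  rw [integral_sub (integrable_const _) (integrable_pow this), survival, genFun]
  simp

end

namespace CriticalOffspring

variable {α : ℝ} {L : ℝ → ℝ} {ν : Measure ℕ}

/-- The integral of a nonintegrable function is `0` by convention, so mean one forces integrability.
-/
theorem integrable_id (hν : CriticalOffspring α L ν) : Integrable (fun k : ℕ => (k : ℝ)) ν := by
  by_contra h
  have := hν.mean_one
  rw [integral_undef h] at this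
  exact zero_ne_one this

theorem decr_survival (hν : CriticalOffspring α L ν) {q : ℝ} (h0 : 0 < q) (h1 : q ≤ 1) :
    decr (survival ν) q = q ^ α * L q := by
  rw [decr, survival, hν.genFun_eq (1 - q) (by linarith) (by linarith), sub_sub_cancel,
    Real.rpow_add h0, Real.rpow_one]
  field_simp
  ring


/-- The geometric sum makes the integrand visibly decreasing in `q`, which gives monotonicity of the
relative decrement. -/
theorem survival_div_eq [IsProbabilityMeasure ν] {q : ℝ} (h0 : 0 < q) (h1 : q ≤ 1) :
    survival ν q / q = ∫ k, ∑ i ∈ Finset.range k, (1 - q) ^ i ∂ν := by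
  rw [survival_eq_integral ⟨h0.le, h1⟩, ← integral_div]
  refine integral_congr_ae (Eventually.of_forall fun k => ?_)
  have := mul_neg_geom_sum (1 - q) k
  rw [sub_sub_cancel] at this
  simp only
  rw [← this]
  field_simp

theorem integrable_geom_sum (hν : CriticalOffspring α L ν) {q : ℝ} (h0 : 0 < q) (h1 : q ≤ 1) :
    Integrable (fun k => ∑ i ∈ Finset.range k, (1 - q) ^ i) ν := by
  refine hν.integrable_id.mono' measurable_from_nat.aestronglyMeasurable
    (Eventually.of_forall fun k => ?_)
  rw [Real.norm_eq_abs, abs_of_nonneg (Finset.sum_nonneg fun i _ => pow_nonneg (by linarith) _)]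
  calc ∑ i ∈ Finset.range k, (1 - q) ^ i ≤ ∑ i ∈ Finset.range k, (1 : ℝ) :=
        Finset.sum_le_sum fun i _ => pow_le_one₀ (by linarith) (by linarith)
    _ = k := by simp

variable [IsProbabilityMeasure ν]

theorem decr_survival_mono (hν : CriticalOffspring α L ν) :
    MonotoneOn (decr (survival ν)) (Set.Ioc 0 1) := by
  intro p hp q hq hpq
  rw [decr, decr, survival_div_eq hp.1 hp.2, survival_div_eq hq.1 hq.2]
  refine sub_le_sub_left (integral_mono (hν.integrable_geom_sum hq.1 hq.2)
    (hν.integrable_geom_sum hp.1 hp.2) fun k => ?_) 1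
  refine Finset.sum_le_sum fun i _ => pow_le_pow_left₀ (by linarith [hq.2]) (by linarith) _

/-- `L` is known to be positive only near zero; monotonicity carries the sign to all of `(0, 1]`. -/
theorem decr_survival_pos (hν : CriticalOffspring α L ν) {q : ℝ} (h0 : 0 < q) (h1 : q ≤ 1) :
    0 < decr (survival ν) q := by
  obtain ⟨p, hL, hp⟩ := (hν.slowlyVarying.1.and (Ioc_mem_nhdsGT h0)).exists
  have h2 := hν.decr_survival_mono ⟨hp.1, hp.2.trans h1⟩ ⟨h0, h1⟩ hp.2
  refine lt_of_lt_of_le ?_ h2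
  rw [hν.decr_survival hp.1 (hp.2.trans h1)]
  exact mul_pos (Real.rpow_pos_of_pos hp.1 _) hL

/-- If `g q` vanished, the offspring number would be almost surely zero, contradicting mean one. -/
theorem survival_pos (hν : CriticalOffspring α L ν) {q : ℝ} (h0 : 0 < q) (h1 : q ≤ 1) :
    0 < survival ν q := by
  have hs : (1 - q) ∈ Set.Icc (0 : ℝ) 1 := ⟨by linarith, by linarith⟩
  have hnn : ∀ k : ℕ, 0 ≤ 1 - (1 - q) ^ k := fun k => sub_nonneg.2 (pow_le_one₀ hs.1 hs.2)
  rw [survival_eq_integral ⟨h0.le, h1⟩]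
  refine lt_of_le_of_ne (integral_nonneg hnn) fun h => ?_
  have h2 := (integral_eq_zero_iff_of_nonneg hnn ((integrable_const _).sub (integrable_pow hs))).1
    h.symm
  have h3 : ∫ k, (k : ℝ) ∂ν = 0 := by
    refine integral_eq_zero_of_ae ?_
    filter_upwards [h2] with k hk
    by_contra hne
    have hk0 : k ≠ 0 := fun h => hne (by simp [h])
    have : (1 - q) ^ k < 1 := pow_lt_one₀ hs.1 (by linarith) hk0
    simp only [Pi.zero_apply] at hk
    linarith
  rw [hν.mean_one] at h3
  exact one_ne_zero h3

theorem regVarStep (hν : CriticalOffspring α L ν) : RegVarStep α (survival ν) where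
  pos _ h0 h1 := hν.survival_pos h0 h1
  lt q h0 h1 := by
    have := hν.decr_survival_pos h0 h1
    rwa [decr, sub_pos, div_lt_one h0] at this
  mono p hp q hq hpq := by
    have hs : ∀ {r : ℝ}, r ∈ Set.Ioc (0 : ℝ) 1 → (1 - r) ∈ Set.Icc (0 : ℝ) 1 := fun hr =>
      ⟨by linarith [hr.2], by linarith [hr.1]⟩
    refine sub_le_sub_left (integral_mono (integrable_pow (hs hq)) (integrable_pow (hs hp))
      fun k => ?_) 1
    exact pow_le_pow_left₀ (hs hq).1 (by linarith) _
  decr_mono := hν.decr_survival_mono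
  decr_rv c hc := by
    have h1 := (hν.slowlyVarying.2 c hc).const_mul (c ^ α)
    rw [mul_one] at h1
    refine h1.congr' ?_
    filter_upwards [Ioc_mem_nhdsGT one_pos,
      tendsto_const_mul_nhdsGT_zero hc (Ioc_mem_nhdsGT one_pos), hν.slowlyVarying.1]
      with q hq hcq hL
    have hcq : c * q ∈ Set.Ioc (0 : ℝ) 1 := hcq
    rw [hν.decr_survival hq.1 hq.2, hν.decr_survival hcq.1 hcq.2, Real.mul_rpow hc.le hq.1.le]
    have := Real.rpow_pos_of_pos hq.1 α
    field_simp

end CriticalOffspring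
-- Negative binomial series and the scaling limit of iterates
/-- The coefficient `Γ(j + α) / (Γ(α) j!)` of `z ^ j` in `(1 - z) ^ (-α)`. -/
noncomputable def negBinCoeff (α : ℝ) (j : ℕ) : ℝ :=
  Real.Gamma (j + α) / (Real.Gamma α * j.factorial)

theorem negBinCoeff_pos {α : ℝ} (hα : 0 < α) (j : ℕ) : 0 < negBinCoeff α j := by
  have h1 : 0 < Real.Gamma (j + α) := Real.Gamma_pos_of_pos (by positivity)
  have h2 := Real.Gamma_pos_of_pos hα
  unfold negBinCoeff; positivity

theorem negBinCoeff_zero {α : ℝ} (hα : 0 < α) : negBinCoeff α 0 = 1 := by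
  have h2 := Real.Gamma_pos_of_pos hα
  simp [negBinCoeff, h2.ne']

theorem Gamma_nat_add {α : ℝ} (hα : 0 < α) (n : ℕ) :
    Real.Gamma (n + α) = (ascPochhammer ℝ n).eval α * Real.Gamma α := by
  induction n with
  | zero => simp
  | succ n ih =>
    have : ((n + 1 : ℕ) : ℝ) + α = (n + α) + 1 := by push_cast; ring
    rw [this, Real.Gamma_add_one (by positivity), ih, ascPochhammer_succ_eval]
    ring

theorem choose_eq_negBinCoeff {α : ℝ} (hα : 0 < α) (n : ℕ) :
    Ring.choose (α + n - 1) n = negBinCoeff α n := by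
  have h1 : Ring.choose (α + n - 1) n = Ring.multichoose α n := by
    rw [Ring.choose]; congr 1; ring
  have h2 := Ring.factorial_nsmul_multichoose_eq_ascPochhammer α n
  rw [Polynomial.ascPochhammer_smeval_eq_eval, nsmul_eq_mul] at h2
  have h3 := Real.Gamma_pos_of_pos hα
  rw [h1, negBinCoeff, Gamma_nat_add hα, ← h2]
  field_simp

theorem hasSum_negBinCoeff {α z : ℝ} (hα : 0 < α) (hz : |z| < 1) :
    HasSum (fun j => negBinCoeff α j * z ^ j) ((1 - z) ^ (-α)) := by
  have h := (Real.one_div_one_sub_rpow_hasFPowerSeriesOnBall_zero α).hasSum (y := z)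
    (by simpa [enorm_eq_nnnorm] using! hz)
  simp only [zero_add] at h
  rw [Real.rpow_neg (by linarith [(abs_lt.1 hz).2]), ← one_div]
  refine (congrArg (HasSum · _) (funext fun j => ?_)).mpr h
  simp [choose_eq_negBinCoeff hα, mul_comm]

theorem tendsto_one_sub_exp_div {ι : Type*} {l : Filter ι} {Q : ι → ℝ}
    (hQ : Tendsto Q l (𝓝[>] 0)) {c : ℝ} :
    Tendsto (fun i => (1 - Real.exp (-(c * Q i))) / Q i) l (𝓝 c) := by
  have hd : HasDerivAt (fun y : ℝ => 1 - Real.exp (-(c * y))) c 0 := by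
    have h1 : HasDerivAt (fun y : ℝ => -(c * y)) (-c) 0 := by
      simpa using ((hasDerivAt_id (0 : ℝ)).const_mul c).fun_neg
    simpa using h1.exp.const_sub 1
  rw [hasDerivAt_iff_tendsto_slope] at hd
  have h2 : Tendsto Q l (𝓝[≠] 0) :=
    hQ.mono_right (nhdsWithin_mono _ fun y hy => ne_of_gt hy)
  refine (hd.comp h2).congr fun i => ?_
  simp [slope_def_field]

/-- Index sequences of the reduced process: `m n → ∞` is of smaller order than `n`, the
generation `p n` lies `k n ~ x m n` generations before generation `n`. -/
structure IndexScaling (x : ℝ) (m p k : ℕ → ℕ) : Prop where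
  tendsto_m : Tendsto m atTop atTop
  m_div : Tendsto (fun n => (m n : ℝ) / n) atTop (𝓝 0)
  k_div : Tendsto (fun n => (k n : ℝ) / m n) atTop (𝓝 x)
  add_eq : ∀ᶠ n in atTop, p n + k n = n

namespace IndexScaling

variable {x : ℝ} {m p k : ℕ → ℕ}

theorem tendsto_k (h : IndexScaling x m p k) (hx : 0 < x) : Tendsto k atTop atTop := by
  have hmR : Tendsto (fun i => (m i : ℝ)) atTop atTop :=
    tendsto_natCast_atTop_atTop.comp h.tendsto_m
  rw [← tendsto_natCast_atTop_iff (R := ℝ)]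
  refine (h.k_div.pos_mul_atTop hx hmR).congr' ?_
  filter_upwards [h.tendsto_m.eventually (eventually_gt_atTop 0)] with i hi
  have : (m i : ℝ) ≠ 0 := by exact_mod_cast hi.ne'
  field_simp

theorem k_div_id (h : IndexScaling x m p k) : Tendsto (fun n => (k n : ℝ) / n) atTop (𝓝 0) := by
  have := h.k_div.mul h.m_div
  rw [mul_zero] at this
  refine this.congr' ?_
  filter_upwards [h.tendsto_m.eventually (eventually_gt_atTop 0)] with i hi
  have : (m i : ℝ) ≠ 0 := by exact_mod_cast hi.ne'
  field_simp

theorem p_div_id (h : IndexScaling x m p k) : Tendsto (fun n => (p n : ℝ) / n) atTop (𝓝 1) := by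
  have := h.k_div_id.const_sub 1
  rw [sub_zero] at this
  refine this.congr' ?_
  filter_upwards [h.add_eq, eventually_gt_atTop 0] with n hn hn0
  have e : (n : ℝ) ≠ 0 := by exact_mod_cast hn0.ne'
  have : (p n : ℝ) + k n = n := by exact_mod_cast hn
  field_simp
  linarith

theorem tendsto_p (h : IndexScaling x m p k) : Tendsto p atTop atTop := by
  rw [← tendsto_natCast_atTop_iff (R := ℝ)]
  refine (h.p_div_id.pos_mul_atTop one_pos tendsto_natCast_atTop_atTop).congr' ?_
  filter_upwards [eventually_gt_atTop 0] with n hn0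
  have e : (n : ℝ) ≠ 0 := by exact_mod_cast hn0.ne'
  field_simp

theorem k_div_p (h : IndexScaling x m p k) : Tendsto (fun n => (k n : ℝ) / p n) atTop (𝓝 0) := by
  have := h.k_div_id.div h.p_div_id one_ne_zero
  rw [zero_div] at this
  refine this.congr' ?_
  filter_upwards [eventually_gt_atTop 0] with n hn0
  have e : (n : ℝ) ≠ 0 := by exact_mod_cast hn0.ne'
  simp only [Pi.div_apply]
  rw [div_div_div_cancel_right₀ e]

end IndexScaling

namespace RegVarStep

variable {α : ℝ} {g : ℝ → ℝ} {x : ℝ} {m p k : ℕ → ℕ}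

theorem one_sub_exp_mem (h : RegVarStep α g) {c : ℝ} (hc : 0 < c) (n : ℕ) :
    1 - Real.exp (-(c * g^[n] 1)) ∈ Set.Ioc (0 : ℝ) 1 := by
  have h1 := h.orbit_pos n
  have h2 : Real.exp (-(c * g^[n] 1)) < 1 := by
    rw [Real.exp_lt_one_iff, neg_lt_zero]; positivity
  exact ⟨by linarith, by linarith [Real.exp_pos (-(c * g^[n] 1))]⟩

theorem tendsto_orbit_sub_iterate_exp (h : RegVarStep α g) (hα : 0 < α)
    (hm : Tendsto m atTop atTop) (hmn : Tendsto (fun n => (m n : ℝ) / n) atTop (𝓝 0)) {c : ℝ}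
    (hc : 0 < c) :
    Tendsto (fun n => (g^[n] 1 - g^[n] (1 - Real.exp (-(c * g^[m n] 1)))) / (m n * incr g n))
      atTop (𝓝 (c ^ (-α))) :=
  h.tendsto_orbit_sub_iterate hα hc hm tendsto_id hmn (fun n => (h.one_sub_exp_mem hc (m n)).2)
    (tendsto_one_sub_exp_div (h.tendsto_orbit.comp hm))

/-- The limit of the joint generating function of the reduced process, in terms of iterates. -/
theorem tendsto_iterate_sub_iterate (h : RegVarStep α g) (hα : 0 < α) (hx : 0 < x)
    (hs : IndexScaling x m p k) {c t : ℝ} (hc : 0 < c) (ht : t ∈ Set.Ico (0 : ℝ) 1) :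
    Tendsto (fun n => (g^[p n] (g^[k n] 1) - g^[p n] (g^[k n] 1 -
        t * (g^[k n] 1 - g^[k n] (1 - Real.exp (-(c * g^[m n] 1)))))) / (m n * incr g n)) atTop
      (𝓝 (x * ((1 - t * (1 - (1 + c ^ (-α) / x) ^ (-(1 / α)))) ^ (-α) - 1))) := by
  have hkt := hs.tendsto_k hx
  set q : ℕ → ℝ := fun n => 1 - Real.exp (-(c * g^[m n] 1)) with hq
  have hq1 : ∀ n, q n ≤ 1 := fun n => (h.one_sub_exp_mem hc (m n)).2
  have hq0 : ∀ n, 0 < q n := fun n => (h.one_sub_exp_mem hc (m n)).1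
  have h1 := h.tendsto_iterate_div_orbit hα hc hx hs.tendsto_m hkt hs.k_div hq1
    (tendsto_one_sub_exp_div (h.tendsto_orbit.comp hs.tendsto_m))
  set A := (1 + c ^ (-α) / x) ^ (-(1 / α)) with hA
  have hA0 : 0 < A := by positivity
  have hpos : 0 < 1 - t * (1 - A) := by nlinarith [ht.1, ht.2]
  have h2 : Tendsto (fun n => (g^[k n] 1 - t * (g^[k n] 1 - g^[k n] (q n))) / g^[k n] 1) atTop
      (𝓝 (1 - t * (1 - A))) := by
    refine (((h1.const_sub 1).const_mul t).const_sub 1).congr fun n => ?_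
    have := (h.orbit_pos (k n)).ne'
    field_simp
  -- Both iterates are compared with `Q_p` in units of `k Δ_p`; the subtracted reference term, with
  -- ratio one, produces the `-1`. Then `k / m → x` and `Δ_p / Δ_n → 1` convert the units.
  have h3 := h.tendsto_orbit_sub_iterate hα hpos hkt hs.tendsto_p hs.k_div_p (fun n => by
    have e1 := h.iterate_mono (k n) (hq0 n) (hq1 n) le_rfl
    have e2 := h.orbit_le_one (k n)
    nlinarith [ht.1]) h2
  have h4 := h.tendsto_orbit_sub_iterate hα one_pos hkt hs.tendsto_p hs.k_div_p
    (q := fun n => g^[k n] 1) (fun n => h.orbit_le_one (k n))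
    (tendsto_const_nhds.congr fun n => (div_self (h.orbit_pos (k n)).ne').symm)
  rw [Real.one_rpow] at h4
  have h5 := h.tendsto_incr_div hα hs.tendsto_p tendsto_id hs.p_div_id
  have h6 := (hs.k_div.mul h5).mul (h3.sub h4)
  rw [mul_one] at h6
  refine h6.congr' ?_
  filter_upwards [hs.tendsto_m.eventually (eventually_gt_atTop 0),
    hkt.eventually (eventually_gt_atTop 0)] with n hn hn'
  have e1 : (m n : ℝ) ≠ 0 := by exact_mod_cast hn.ne'
  have e2 : (k n : ℝ) ≠ 0 := by exact_mod_cast hn'.ne'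
  have e3 := (h.incr_pos (p n)).ne'
  have e4 := (h.incr_pos n).ne'
  simp only [id]
  field_simp
  ring

end RegVarStep
-- Convolution powers and generating functions on survival
theorem UnitWeight.of_bounded {Ω : Type*} [MeasurableSpace Ω] {μ : Measure Ω} [IsFiniteMeasure μ]
    {W T : Ω → ℝ} (hW : Measurable W) (hT : Measurable T) {B : ℝ}
    (hWB : ∀ ω, W ω ∈ Set.Icc 0 B) (hT1 : ∀ ω, T ω ∈ Set.Icc (0 : ℝ) 1) : UnitWeight μ W T where
  aemeasurable := hT.aemeasurable
  integrable := by
    refine Integrable.of_bound (hW.mul hT).aestronglyMeasurable B (Eventually.of_forall fun ω => ?_)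
    rw [Real.norm_eq_abs, abs_of_nonneg (mul_nonneg (hWB ω).1 (hT1 ω).1)]
    exact (mul_le_of_le_one_right (hWB ω).1 (hT1 ω).2).trans (hWB ω).2
  nonneg := Eventually.of_forall fun ω => (hWB ω).1
  mem := Eventually.of_forall hT1

section Convolution

variable {M : Measure ℝ} [IsProbabilityMeasure M]

theorem isProbabilityMeasure_convPow (j : ℕ) : IsProbabilityMeasure (convPow M j) := by
  induction j with
  | zero => rw [convPow]; infer_instance
  | succ j ih => rw [convPow]; infer_instance

theorem ae_nonneg_convPow (h : ∀ᵐ y ∂M, 0 ≤ y) (j : ℕ) : ∀ᵐ y ∂(convPow M j), 0 ≤ y := by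
  induction j with
  | zero => simp [convPow, ae_dirac_eq]
  | succ j ih =>
    have := isProbabilityMeasure_convPow (M := M) j
    rw [convPow, Measure.conv, ae_map_iff (by fun_prop) measurableSet_Ici]
    filter_upwards [Measure.quasiMeasurePreserving_fst.ae ih,
      Measure.quasiMeasurePreserving_snd.ae h] with z h1 h2
    exact add_nonneg h1 h2

theorem integral_exp_convPow (l : ℝ) (j : ℕ) :
    ∫ y, Real.exp (-(l * y)) ∂(convPow M j) = (∫ y, Real.exp (-(l * y)) ∂M) ^ j := by
  induction j with
  | zero => simp [convPow]
  | succ j ih =>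
    have := isProbabilityMeasure_convPow (M := M) j
    rw [convPow, Measure.conv, integral_map (by fun_prop) (by fun_prop), pow_succ, ← ih,
      ← integral_prod_mul]
    refine integral_congr_ae (Eventually.of_forall fun z => ?_)
    simp only
    rw [← Real.exp_add]
    ring_nf

end Convolution

namespace IsOffspringFamily

variable {Ω : Type*} [MeasurableSpace Ω] {P : Measure Ω}
  {ν : Measure ℕ} {ξ : List ℕ → Ω → ℕ}

theorem measurable_popSize (hξ : IsOffspringFamily P ν ξ) (n : ℕ) :
    Measurable fun ω => popSize (fun u => ξ u ω) n :=
  (GaltonWatson.measurable_popSize n).comp hξ.measurable_family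

theorem measurable_reducedSize (hξ : IsOffspringFamily P ν ξ) (m n : ℕ) :
    Measurable fun ω => reducedSize (fun u => ξ u ω) m n :=
  (GaltonWatson.measurable_reducedSize m n).comp hξ.measurable_family

variable [IsProbabilityMeasure P]

theorem isProbabilityMeasure_law (hξ : IsOffspringFamily P ν ξ) : IsProbabilityMeasure ν := by
  rw [← hξ.law []]; exact Measure.isProbabilityMeasure_map (hξ.measurable []).aemeasurable

theorem integral_ite_pow_popSize (hξ : IsOffspringFamily P ν ξ) {s : ℝ}
    (hs : s ∈ Set.Icc (0 : ℝ) 1) (n : ℕ) :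
    ∫ ω, (if popSize (fun u => ξ u ω) n = 0 then 0 else s ^ popSize (fun u => ξ u ω) n) ∂P =
      (survival ν)^[n] 1 - (survival ν)^[n] (1 - s) := by
  have hint : ∀ {r : ℝ}, r ∈ Set.Icc (0 : ℝ) 1 →
      Integrable (fun ω => r ^ popSize (fun u => ξ u ω) n) P := fun {r} hr => by
    refine Integrable.of_bound (Measurable.aestronglyMeasurable ?_) 1
      (Eventually.of_forall fun ω => ?_)
    · exact (measurable_from_nat (f := fun j => r ^ j)).comp (hξ.measurable_popSize n)
    · rw [Real.norm_eq_abs, abs_of_nonneg (pow_nonneg hr.1 _)]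
      exact pow_le_one₀ hr.1 hr.2
  have h0 : (0 : ℝ) ∈ Set.Icc (0 : ℝ) 1 := ⟨le_rfl, zero_le_one⟩
  have key : ∀ j : ℕ, (if j = 0 then 0 else s ^ j) = s ^ j - 0 ^ j := fun j => by
    split_ifs with h <;> simp [h]
  simp only [key]
  rw [integral_sub (hint hs) (hint h0), hξ.integral_pow_popSize hs, hξ.integral_pow_popSize h0,
    genFun_iterate, genFun_iterate ν n 0, sub_zero]
  ring

theorem integral_ite_pow_mul_pow (hξ : IsOffspringFamily P ν ξ) {s t : ℝ}
    (hs : s ∈ Set.Icc (0 : ℝ) 1) (ht : t ∈ Set.Icc (0 : ℝ) 1) {n p k : ℕ} (hn : p + k = n) :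
    ∫ ω, (if popSize (fun u => ξ u ω) n = 0 then 0 else s ^ popSize (fun u => ξ u ω) n) *
        t ^ reducedSize (fun u => ξ u ω) p n ∂P =
      (survival ν)^[p] ((survival ν)^[k] 1) - (survival ν)^[p] ((survival ν)^[k] 1 -
        t * ((survival ν)^[k] 1 - (survival ν)^[k] (1 - s))) := by
  subst hn
  have h0 : (0 : ℝ) ∈ Set.Icc (0 : ℝ) 1 := ⟨le_rfl, zero_le_one⟩
  have hint0 : Integrable (fun ω => (0 : ℝ) ^ popSize (fun u => ξ u ω) (p + k)) P := by
    refine Integrable.of_bound (Measurable.aestronglyMeasurable ?_) 1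
      (Eventually.of_forall fun ω => ?_)
    · exact (measurable_from_nat (f := fun j => (0 : ℝ) ^ j)).comp (hξ.measurable_popSize _)
    · rw [Real.norm_eq_abs, abs_of_nonneg (pow_nonneg le_rfl _)]
      exact pow_le_one₀ le_rfl zero_le_one
  have hint : Integrable (fun ω => s ^ popSize (fun u => ξ u ω) (p + k) *
      t ^ reducedSize (fun u => ξ u ω) p (p + k)) P := by
    refine Integrable.of_bound (Measurable.aestronglyMeasurable ?_) 1
      (Eventually.of_forall fun ω => ?_)
    · exact ((measurable_from_nat (f := fun j => s ^ j)).comp (hξ.measurable_popSize _)).mul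
        ((measurable_from_nat (f := fun j => t ^ j)).comp (hξ.measurable_reducedSize _ _))
    · rw [Real.norm_eq_abs, abs_of_nonneg (mul_nonneg (pow_nonneg hs.1 _) (pow_nonneg ht.1 _))]
      exact mul_le_one₀ (pow_le_one₀ hs.1 hs.2) (pow_nonneg ht.1 _) (pow_le_one₀ ht.1 ht.2)
  -- At extinction `Z(p, n) = 0`, so the factor in `t` is `1` there and subtracting `0 ^ Z(n)`
  -- removes exactly that event.
  have key : ∀ ω, (if popSize (fun u => ξ u ω) (p + k) = 0 then 0 else
      s ^ popSize (fun u => ξ u ω) (p + k)) * t ^ reducedSize (fun u => ξ u ω) p (p + k) =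
      s ^ popSize (fun u => ξ u ω) (p + k) * t ^ reducedSize (fun u => ξ u ω) p (p + k) -
        0 ^ popSize (fun u => ξ u ω) (p + k) := fun ω => by
    split_ifs with h
    · simp [h, (reducedSize_eq_zero_iff (fun u => ξ u ω) p k).2 h]
    · simp [h]
  simp only [key]
  rw [integral_sub hint hint0, hξ.integral_pow_popSize_mul_pow_reducedSize hs ht,
    hξ.integral_pow_popSize h0, Function.iterate_add_apply, genFun_iterate ν p, genFun_iterate ν p,
    genFun_iterate ν k, genFun_iterate ν k, sub_zero]
  ring_nf

end IsOffspringFamily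
-- The gamma and negative binomial limit weights
theorem exp_neg_mem_Icc {y : ℝ} (hy : 0 ≤ y) : Real.exp (-y) ∈ Set.Icc (0 : ℝ) 1 :=
  ⟨(Real.exp_pos _).le, by rw [Real.exp_le_one_iff]; linarith⟩

section GammaWeight

variable {α : ℝ}

/-- The weight has infinite mass at infinity; multiplied by `exp (-y)` it becomes the gamma density.
-/
theorem unitWeight_gamma (hα : 0 < α) : UnitWeight (volume.restrict (Set.Ioi (0 : ℝ)))
    (fun y => y ^ (α - 1) / Real.Gamma α) (fun y => Real.exp (-y)) where
  aemeasurable := (by fun_prop : Measurable fun y : ℝ => Real.exp (-y)).aemeasurable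
  integrable := by
    refine ((Real.GammaIntegral_convergent hα).div_const (Real.Gamma α)).congr
      (Eventually.of_forall fun y => ?_)
    simp only
    ring
  nonneg := by
    filter_upwards [ae_restrict_mem measurableSet_Ioi] with y hy
    have := Real.Gamma_pos_of_pos hα
    have : 0 < y := hy
    positivity
  mem := by
    filter_upwards [ae_restrict_mem measurableSet_Ioi] with y hy
    exact exp_neg_mem_Icc (le_of_lt hy)

theorem integral_gamma_pow (hα : 0 < α) (k : ℕ) :
    ∫ y in Set.Ioi (0 : ℝ), y ^ (α - 1) / Real.Gamma α * Real.exp (-y) ^ (k + 1) =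
      ((k : ℝ) + 1) ^ (-α) := by
  have h1 := Real.integral_rpow_mul_exp_neg_mul_Ioi hα (show (0 : ℝ) < k + 1 by positivity)
  have h2 := Real.Gamma_pos_of_pos hα
  have h3 : ∀ y : ℝ, y ^ (α - 1) / Real.Gamma α * Real.exp (-y) ^ (k + 1) =
      y ^ (α - 1) * Real.exp (-(((k : ℝ) + 1) * y)) / Real.Gamma α := fun y => by
    rw [← Real.exp_nat_mul]; push_cast; ring_nf
  simp_rw [h3]
  rw [integral_div, h1, Real.rpow_neg (by positivity), one_div, Real.inv_rpow (by positivity)]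
  field_simp

theorem integral_ite_gamma (hα : 0 < α) :
    ∫ y in Set.Ioi (0 : ℝ), (if Real.exp (-1) ≤ Real.exp (-y) then
      y ^ (α - 1) / Real.Gamma α else 0) = 1 / Real.Gamma (α + 1) := by
  have h2 := Real.Gamma_pos_of_pos hα
  have h1 : ∀ y : ℝ, (if Real.exp (-1) ≤ Real.exp (-y) then y ^ (α - 1) / Real.Gamma α else 0) =
      (Set.Iic (1 : ℝ)).indicator (fun y => y ^ (α - 1) / Real.Gamma α) y := fun y => by
    simp [Set.indicator_apply]
  simp_rw [h1]
  rw [setIntegral_indicator measurableSet_Iic, Set.Ioi_inter_Iic,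
    ← intervalIntegral.integral_of_le zero_le_one, intervalIntegral.integral_div,
    integral_rpow (Or.inl (by linarith)), Real.Gamma_add_one hα.ne', sub_add_cancel,
    Real.zero_rpow hα.ne', Real.one_rpow]
  field_simp
  ring

end GammaWeight

section NegBinWeight

variable {α x Φ : ℝ}

/-- Coefficients of `x ((1 - Φ z) ^ (-α) - 1)`. -/
noncomputable def negBinWeight (α x Φ : ℝ) (i : ℕ) : ℝ :=
  if i = 0 then 0 else x * (negBinCoeff α i * Φ ^ i)

theorem hasSum_negBinWeight (hα : 0 < α) (hΦ : Φ ∈ Set.Ico (0 : ℝ) 1) {z : ℝ}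
    (hz : z ∈ Set.Icc (0 : ℝ) 1) :
    HasSum (fun i => negBinWeight α x Φ i * z ^ i) (x * ((1 - z * Φ) ^ (-α) - 1)) := by
  have h1 : |z * Φ| < 1 := by
    rw [abs_of_nonneg (mul_nonneg hz.1 hΦ.1)]
    nlinarith [hz.1, hz.2, hΦ.1, hΦ.2]
  have h2 := (hasSum_ite_sub_hasSum (hasSum_negBinCoeff hα h1) 0).mul_left x
  rw [negBinCoeff_zero hα, pow_zero, mul_one] at h2
  refine (congrArg (HasSum · _) (funext fun i => ?_)).mpr h2
  rw [negBinWeight]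
  split_ifs
  · simp
  · rw [mul_pow]; ring

theorem negBinWeight_nonneg (hα : 0 < α) (hx : 0 < x) (hΦ : Φ ∈ Set.Ico (0 : ℝ) 1) (i : ℕ) :
    0 ≤ negBinWeight α x Φ i := by
  rw [negBinWeight]
  split_ifs
  · exact le_rfl
  · have := negBinCoeff_pos hα i
    have := hΦ.1
    positivity

/-- The counting variable is encoded as `2 ^ (-i)`, so the moments are values of the power series at
powers of `1 / 2`. -/
theorem unitWeight_negBin (hα : 0 < α) (hx : 0 < x) (hΦ : Φ ∈ Set.Ico (0 : ℝ) 1) :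
    UnitWeight Measure.count (negBinWeight α x Φ) (fun i : ℕ => (1 / 2 : ℝ) ^ i) where
  aemeasurable := measurable_from_nat.aemeasurable
  integrable := integrable_count_iff.2
    (hasSum_negBinWeight (x := x) hα hΦ (z := 1 / 2) (by norm_num)).summable.abs
  nonneg := Eventually.of_forall (negBinWeight_nonneg hα hx hΦ)
  mem := Eventually.of_forall fun i => ⟨by positivity, pow_le_one₀ (by norm_num) (by norm_num)⟩

theorem integral_negBinWeight_pow (hα : 0 < α) (hx : 0 < x) (hΦ : Φ ∈ Set.Ico (0 : ℝ) 1) (k : ℕ) :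
    ∫ i, negBinWeight α x Φ i * ((1 / 2 : ℝ) ^ i) ^ (k + 1) ∂Measure.count =
      x * ((1 - (1 / 2) ^ (k + 1) * Φ) ^ (-α) - 1) := by
  rw [integral_countable ((unitWeight_negBin hα hx hΦ).integrable_mul_pow k)]
  rw [← (hasSum_negBinWeight (x := x) hα hΦ (z := (1 / 2) ^ (k + 1))
    ⟨by positivity, pow_le_one₀ (by norm_num) (by norm_num)⟩).tsum_eq]
  refine tsum_congr fun i => ?_
  simp only [Measure.real, Measure.count_singleton, ENNReal.toReal_one, one_smul]
  rw [← pow_mul, ← pow_mul, mul_comm i]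

/-- A continuous function `φ` such that `t φ(t)` separates `t = 2⁻ʲ` from the other powers
of `1 / 2`. -/
noncomputable def dyadicTent (j : ℕ) (t : ℝ) : ℝ := 2 ^ j * tent ((1 / 2) ^ j) (2 ^ (j + 1)) t

theorem continuous_dyadicTent (j : ℕ) : Continuous (dyadicTent j) :=
  continuous_const.mul (continuous_tent _ _)

theorem mul_dyadicTent (j i : ℕ) :
    (1 / 2 : ℝ) ^ i * dyadicTent j ((1 / 2) ^ i) = if i = j then 1 else 0 := by
  rw [dyadicTent]
  split_ifs with h
  · subst h
    rw [← mul_assoc, ← mul_pow]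
    simp [tent]
  · suffices tent ((1 / 2) ^ j) (2 ^ (j + 1)) ((1 / 2) ^ i) = 0 by rw [this]; simp
    -- The half-width of the tent is the distance from `2 ^ (-j)` to its nearest neighbour `2 ^
    -- (-(j+1))`.
    have hkey : (1 / 2 : ℝ) ^ (j + 1) ≤ |(1 / 2 : ℝ) ^ i - (1 / 2) ^ j| := by
      rcases lt_or_gt_of_ne h with h | h
      · have h1 : (1 / 2 : ℝ) ^ j ≤ (1 / 2) ^ (i + 1) :=
          pow_le_pow_of_le_one (by norm_num) (by norm_num) h
        have h2 : (0 : ℝ) < (1 / 2) ^ j := by positivity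
        refine le_trans ?_ (le_abs_self _)
        rw [pow_succ] at h1 ⊢
        linarith
      · have h1 : (1 / 2 : ℝ) ^ i ≤ (1 / 2) ^ (j + 1) :=
          pow_le_pow_of_le_one (by norm_num) (by norm_num) h
        refine le_trans ?_ (neg_le_abs _)
        rw [pow_succ] at h1 ⊢
        linarith
    have h3 : (2 : ℝ) ^ (j + 1) * (1 / 2) ^ (j + 1) = 1 := by rw [← mul_pow]; norm_num
    rw [tent, max_eq_left]
    push_cast
    have := mul_le_mul_of_nonneg_left hkey (show (0 : ℝ) ≤ 2 ^ (j + 1) by positivity)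
    linarith

theorem integral_negBinWeight_dyadicTent {j : ℕ} (hj : 1 ≤ j) (hα : 0 < α) (hx : 0 < x)
    (hΦ : Φ ∈ Set.Ico (0 : ℝ) 1) :
    ∫ i, negBinWeight α x Φ i * (1 / 2 : ℝ) ^ i * dyadicTent j ((1 / 2) ^ i) ∂Measure.count =
      x * (negBinCoeff α j * Φ ^ j) := by
  rw [integral_countable ((unitWeight_negBin hα hx hΦ).integrable_mul_continuous
    (continuous_dyadicTent j)), tsum_eq_single j]
  · rw [mul_assoc, mul_dyadicTent, negBinWeight, if_neg (by omega)]
    simp [Measure.real]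
  · intro i hi
    rw [mul_assoc, mul_dyadicTent, if_neg hi]
    simp

end NegBinWeight

/-! ### Probability of the small-deviation event -/

section ExpPop

variable {Ω : Type*} {ν : Measure ℕ} {ξ : List ℕ → Ω → ℕ} {α : ℝ} {L : ℝ → ℝ}

/-- The probability scale `m n (Q_n - Q_{n+1})`. -/
noncomputable def scale (ν : Measure ℕ) (m : ℕ → ℕ) (n : ℕ) : ℝ :=
  m n * RegVarStep.incr (survival ν) n

theorem scale_nonneg [IsProbabilityMeasure ν] (hν : CriticalOffspring α L ν) (m : ℕ → ℕ) (n : ℕ) :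
    0 ≤ scale ν m n :=
  mul_nonneg (Nat.cast_nonneg _) (hν.regVarStep.incr_pos n).le

/-- `exp (-Q_{m n} Z(n))`. -/
noncomputable def expPop (ν : Measure ℕ) (ξ : List ℕ → Ω → ℕ) (m : ℕ → ℕ) (n : ℕ) (ω : Ω) : ℝ :=
  Real.exp (-((survival ν)^[m n] 1 * popSize (fun u => ξ u ω) n))

theorem expPop_mem [IsProbabilityMeasure ν] (hν : CriticalOffspring α L ν) (m : ℕ → ℕ) (n : ℕ)
    (ω : Ω) : expPop ν ξ m n ω ∈ Set.Icc (0 : ℝ) 1 :=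
  exp_neg_mem_Icc (mul_nonneg (hν.regVarStep.orbit_pos _).le (Nat.cast_nonneg _))

theorem expPop_pow (m : ℕ → ℕ) (n : ℕ) (i : ℕ) (ω : Ω) :
    expPop ν ξ m n ω ^ i =
      Real.exp (-(i * (survival ν)^[m n] 1)) ^ popSize (fun u => ξ u ω) n := by
  rw [expPop, ← Real.exp_nat_mul, ← Real.exp_nat_mul]; ring_nf

end ExpPop

namespace IsOffspringFamily

variable {Ω : Type*} [MeasurableSpace Ω] {P : Measure Ω} {ν : Measure ℕ}
  {ξ : List ℕ → Ω → ℕ} {α x : ℝ} {L : ℝ → ℝ} {m p k : ℕ → ℕ}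

theorem measurable_expPop (hξ : IsOffspringFamily P ν ξ) (m : ℕ → ℕ) (n : ℕ) :
    Measurable (expPop ν ξ m n) :=
  (measurable_from_nat (f := fun j => Real.exp (-((survival ν)^[m n] 1 * j)))).comp
    (hξ.measurable_popSize n)

variable [IsProbabilityMeasure P]

/-- The normalised indicator of survival to generation `n`. -/
noncomputable def aliveWeight (ν : Measure ℕ) (ξ : List ℕ → Ω → ℕ) (m : ℕ → ℕ) (n : ℕ) (ω : Ω) :
    ℝ := (if popSize (fun u => ξ u ω) n = 0 then 0 else 1) / scale ν m n

theorem unitWeight_alive (hξ : IsOffspringFamily P ν ξ) (hν : CriticalOffspring α L ν)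
    (m : ℕ → ℕ) (n : ℕ) : UnitWeight P (aliveWeight ν ξ m n) (expPop ν ξ m n) := by
  have := hξ.isProbabilityMeasure_law
  -- If `m n = 0` the scale is zero, and division by zero makes both the weight and its bound
  -- vanish.
  refine UnitWeight.of_bounded (B := 1 / scale ν m n)
    ((measurable_from_nat (f := fun j => (if j = 0 then 0 else 1) / scale ν m n)).comp
      (hξ.measurable_popSize n)) (hξ.measurable_expPop m n) (fun ω => ?_)
    (expPop_mem hν m n)
  have := scale_nonneg hν m n
  constructor
  · unfold aliveWeight; split_ifs <;> positivity
  · unfold aliveWeight; split_ifs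
    · rw [zero_div]; positivity
    · exact le_rfl

/-- The power `i + 1` corresponds to `s = exp (-(i + 1) Q_m)`, for which the iterate asymptotics
give `(i + 1) ^ (-α)`, the matching moment of the gamma weight. -/
theorem tendsto_integral_alive_pow (hξ : IsOffspringFamily P ν ξ) (hν : CriticalOffspring α L ν)
    (hα : 0 < α) (hm : Tendsto m atTop atTop)
    (hmn : Tendsto (fun n => (m n : ℝ) / n) atTop (𝓝 0)) (i : ℕ) :
    Tendsto (fun n => ∫ ω, aliveWeight ν ξ m n ω * expPop ν ξ m n ω ^ (i + 1) ∂P) atTop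
      (𝓝 (∫ y in Set.Ioi (0 : ℝ), y ^ (α - 1) / Real.Gamma α * Real.exp (-y) ^ (i + 1))) := by
  have := hξ.isProbabilityMeasure_law
  have h := hν.regVarStep
  rw [integral_gamma_pow hα]
  refine (h.tendsto_orbit_sub_iterate_exp hα hm hmn
    (show (0 : ℝ) < i + 1 by positivity)).congr fun n => ?_
  have h0 := h.orbit_pos (m n)
  rw [← hξ.integral_ite_pow_popSize (exp_neg_mem_Icc (by positivity)), ← integral_div]
  refine integral_congr_ae (Eventually.of_forall fun ω => ?_)
  simp only [aliveWeight, expPop_pow, scale]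
  push_cast
  split_ifs <;> ring

theorem tendsto_integral_alive_ite (hξ : IsOffspringFamily P ν ξ) (hν : CriticalOffspring α L ν)
    (hα : 0 < α) (hm : Tendsto m atTop atTop)
    (hmn : Tendsto (fun n => (m n : ℝ) / n) atTop (𝓝 0)) :
    Tendsto (fun n => ∫ ω, (if Real.exp (-1) ≤ expPop ν ξ m n ω then aliveWeight ν ξ m n ω else 0)
      ∂P) atTop (𝓝 (1 / Real.Gamma (α + 1))) := by
  rw [← integral_ite_gamma hα]
  refine UnitWeight.tendsto_integral_ite (hξ.unitWeight_alive hν m) (unitWeight_gamma hα)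
    (hξ.tendsto_integral_alive_pow hν hα hm hmn) (Real.exp_pos _) ?_
  refine ae_restrict_of_ae ?_
  filter_upwards [Measure.ae_ne volume (1 : ℝ)] with y hy
  simpa using hy

end IsOffspringFamily
-- Joint limit with the reduced process and conditioning
/-- The Laplace transform `1 - (1 + c ^ (-α) / x) ^ (-1 / α)`. -/
noncomputable def slackLaplace (α x c : ℝ) : ℝ := 1 - (1 + c ^ (-α) / x) ^ (-(1 / α))

theorem slackLaplace_mem {α x c : ℝ} (hα : 0 < α) (hx : 0 < x) (hc : 0 < c) :
    slackLaplace α x c ∈ Set.Ico (0 : ℝ) 1 := by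
  have h1 : 0 < c ^ (-α) / x := by positivity
  have h2 : 0 < (1 + c ^ (-α) / x) ^ (-(1 / α)) := by positivity
  have h3 : (1 + c ^ (-α) / x) ^ (-(1 / α)) ≤ 1 :=
    Real.rpow_le_one_of_one_le_of_nonpos (by linarith) (by rw [neg_nonpos]; positivity)
  constructor <;> rw [slackLaplace] <;> linarith

namespace IsSlackLaw

variable {α x : ℝ} {M : Measure ℝ}

theorem ae_nonneg (hM : IsSlackLaw α M) : ∀ᵐ y ∂M, 0 ≤ y := by
  rw [ae_iff]
  simpa [Set.Iio] using hM.nonneg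

/-- Identifies the parameter `x` as a scaling of `M` by `x ^ (1/α)`. -/
theorem integral_exp_rpow_mul (hM : IsSlackLaw α M) (hα : 0 < α) (hx : 0 < x) {c : ℝ}
    (hc : 0 < c) :
    ∫ y, Real.exp (-(c * x ^ (1 / α) * y)) ∂M = slackLaplace α x c := by
  have h1 : 0 < x ^ (1 / α) := by positivity
  have h2 : (c * x ^ (1 / α)) ^ (-α) = c ^ (-α) / x := by
    rw [Real.mul_rpow hc.le h1.le, ← Real.rpow_mul hx.le, one_div_mul_eq_div, neg_div,
      div_self hα.ne', Real.rpow_neg_one, div_eq_mul_inv]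
  rw [hM.laplace _ (by positivity), h2, slackLaplace,
    Real.rpow_neg (x := 1 + c ^ (-α) / x) (by positivity), one_div (_ ^ _)]

theorem unitWeight_convPow (hM : IsSlackLaw α M) (hx : 0 < x) {B : ℝ} (hB : 0 ≤ B) (j : ℕ) :
    UnitWeight (convPow M j) (fun _ => B) (fun y => Real.exp (-(x ^ (1 / α) * y))) := by
  have := hM.prob
  have := isProbabilityMeasure_convPow (M := M) j
  have hmem : ∀ᵐ y ∂(convPow M j), Real.exp (-(x ^ (1 / α) * y)) ∈ Set.Icc (0 : ℝ) 1 := by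
    filter_upwards [ae_nonneg_convPow hM.ae_nonneg j] with y hy
    exact exp_neg_mem_Icc (by positivity)
  have hmeas : Measurable fun y : ℝ => Real.exp (-(x ^ (1 / α) * y)) := by fun_prop
  refine ⟨hmeas.aemeasurable, ?_, Eventually.of_forall fun _ => hB, hmem⟩
  refine Integrable.const_mul (Integrable.of_bound hmeas.aestronglyMeasurable 1 ?_) B
  filter_upwards [hmem] with y hy
  rw [Real.norm_eq_abs, abs_of_nonneg hy.1]
  exact hy.2

theorem integral_convPow_pow (hM : IsSlackLaw α M) (hα : 0 < α) (hx : 0 < x) (B : ℝ) (j i : ℕ) :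
    ∫ y, B * Real.exp (-(x ^ (1 / α) * y)) ^ (i + 1) ∂(convPow M j) =
      B * slackLaplace α x (i + 1) ^ j := by
  have := hM.prob
  rw [integral_const_mul, ← hM.integral_exp_rpow_mul hα hx (by positivity),
    ← integral_exp_convPow]
  congr 1
  refine integral_congr_ae (Eventually.of_forall fun y => ?_)
  simp only
  rw [← Real.exp_nat_mul]
  push_cast
  ring_nf

theorem integral_ite_convPow (hx : 0 < x) (B : ℝ) (j : ℕ) :
    ∫ y, (if Real.exp (-1) ≤ Real.exp (-(x ^ (1 / α) * y)) then B else 0) ∂(convPow M j) =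
      B * (convPow M j).real (Set.Iic (x ^ (-(1 / α)))) := by
  have h1 : 0 < x ^ (1 / α) := by positivity
  have h2 : ∀ y : ℝ, (if Real.exp (-1) ≤ Real.exp (-(x ^ (1 / α) * y)) then B else 0) =
      (Set.Iic (x ^ (-(1 / α)))).indicator (fun _ => B) y := fun y => by
    have : Real.exp (-1) ≤ Real.exp (-(x ^ (1 / α) * y)) ↔ y ∈ Set.Iic (x ^ (-(1 / α))) := by
      rw [Real.exp_le_exp, neg_le_neg_iff, Real.rpow_neg hx.le, Set.mem_Iic, mul_comm,
        ← le_div_iff₀ h1, one_div (x ^ (1 / α))]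
    simp only [this, Set.indicator_apply]
  simp_rw [h2]
  rw [integral_indicator_const _ measurableSet_Iic, smul_eq_mul, mul_comm]

end IsSlackLaw

namespace IsOffspringFamily

variable {Ω : Type*} [MeasurableSpace Ω] {P : Measure Ω} [IsProbabilityMeasure P] {ν : Measure ℕ}
  {ξ : List ℕ → Ω → ℕ} {α x : ℝ} {L : ℝ → ℝ} {m p k : ℕ → ℕ}

theorem unitWeight_joint (hξ : IsOffspringFamily P ν ξ) (hν : CriticalOffspring α L ν)
    (m p : ℕ → ℕ) {c : ℝ} (hc : 0 < c) (n : ℕ) :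
    UnitWeight P (fun ω => (if popSize (fun u => ξ u ω) n = 0 then 0 else
        Real.exp (-(c * (survival ν)^[m n] 1)) ^ popSize (fun u => ξ u ω) n) / scale ν m n)
      (fun ω => (1 / 2) ^ reducedSize (fun u => ξ u ω) (p n) n) := by
  have := hξ.isProbabilityMeasure_law
  have h0 := hν.regVarStep.orbit_pos (m n)
  have hs := exp_neg_mem_Icc (show 0 ≤ c * (survival ν)^[m n] 1 by positivity)
  have ha := scale_nonneg hν m n
  refine UnitWeight.of_bounded (B := 1 / scale ν m n)
    ((measurable_from_nat (f := fun j => (if j = 0 then 0 else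
      Real.exp (-(c * (survival ν)^[m n] 1)) ^ j) / scale ν m n)).comp (hξ.measurable_popSize n))
    ((measurable_from_nat (f := fun j => (1 / 2 : ℝ) ^ j)).comp
      (hξ.measurable_reducedSize (p n) n)) (fun ω => ?_)
    (fun ω => ⟨by positivity, pow_le_one₀ (by norm_num) (by norm_num)⟩)
  constructor
  · have := hs.1
    split_ifs <;> positivity
  · split_ifs
    · rw [zero_div]; positivity
    · have := pow_le_one₀ hs.1 hs.2 (n := popSize (fun u => ξ u ω) n)
      gcongr

/-- Here `c` is fixed and `2 ^ (-Z(p,n))` is the variable: its moments are the joint generating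
function at `t = 2 ^ (-(i+1))`. The dyadic tent then extracts the coefficient of `t ^ j` in the
limit. -/
theorem tendsto_integral_reduced_exp (hξ : IsOffspringFamily P ν ξ)
    (hν : CriticalOffspring α L ν) (hα : 0 < α) (hx : 0 < x) (hs : IndexScaling x m p k) {c : ℝ}
    (hc : 0 < c) {j : ℕ} (hj : 1 ≤ j) :
    Tendsto (fun n => ∫ ω, (if reducedSize (fun u => ξ u ω) (p n) n = j then
        Real.exp (-(c * (survival ν)^[m n] 1)) ^ popSize (fun u => ξ u ω) n else 0) /
          scale ν m n ∂P) atTop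
      (𝓝 (x * (negBinCoeff α j * slackLaplace α x c ^ j))) := by
  have := hξ.isProbabilityMeasure_law
  have h := hν.regVarStep
  have hΦ := slackLaplace_mem hα hx hc
  rw [← integral_negBinWeight_dyadicTent hj hα hx hΦ]
  refine (UnitWeight.tendsto_integral_mul_continuous (hξ.unitWeight_joint hν m p hc)
    (unitWeight_negBin hα hx hΦ) (fun i => ?_) (continuous_dyadicTent j)).congr' ?_
  · rw [integral_negBinWeight_pow hα hx hΦ]
    have ht : (1 / 2 : ℝ) ^ (i + 1) ∈ Set.Ico (0 : ℝ) 1 :=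
      ⟨by positivity, pow_lt_one₀ (by norm_num) (by norm_num) (by omega)⟩
    refine (h.tendsto_iterate_sub_iterate hα hx hs hc ht).congr' ?_
    filter_upwards [hs.add_eq] with n hn
    have h0 := h.orbit_pos (m n)
    rw [← hξ.integral_ite_pow_mul_pow (exp_neg_mem_Icc (by positivity)) ⟨ht.1, ht.2.le⟩ hn,
      ← integral_div]
    refine integral_congr_ae (Eventually.of_forall fun ω => ?_)
    simp only [scale]
    rw [← pow_mul, ← pow_mul, mul_comm (i + 1)]
    ring
  · filter_upwards [hs.add_eq] with n hn
    refine integral_congr_ae (Eventually.of_forall fun ω => ?_)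
    simp only
    rw [mul_assoc, mul_dyadicTent]
    by_cases hR : reducedSize (fun u => ξ u ω) (p n) n = j
    · have hZ : popSize (fun u => ξ u ω) n ≠ 0 := fun hZ => by
        have := (reducedSize_eq_zero_iff (fun u => ξ u ω) (p n) (k n)).2 (by rw [hn]; exact hZ)
        rw [hn] at this
        omega
      simp [hR, hZ]
    · simp [hR]

/-- The normalised indicator of `Z(p n, n) = j`. -/
noncomputable def reducedWeight (ν : Measure ℕ) (ξ : List ℕ → Ω → ℕ) (m p : ℕ → ℕ) (j n : ℕ)
    (ω : Ω) : ℝ := (if reducedSize (fun u => ξ u ω) (p n) n = j then 1 else 0) / scale ν m n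

theorem unitWeight_reduced (hξ : IsOffspringFamily P ν ξ) (hν : CriticalOffspring α L ν)
    (m p : ℕ → ℕ) (j n : ℕ) : UnitWeight P (reducedWeight ν ξ m p j n) (expPop ν ξ m n) := by
  have := hξ.isProbabilityMeasure_law
  refine UnitWeight.of_bounded (B := 1 / scale ν m n)
    ((measurable_from_nat (f := fun i => (if i = j then 1 else 0) / scale ν m n)).comp
      (hξ.measurable_reducedSize (p n) n)) (hξ.measurable_expPop m n) (fun ω => ?_)
    (expPop_mem hν m n)
  have := scale_nonneg hν m n
  constructor
  · unfold reducedWeight; split_ifs <;> positivity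
  · unfold reducedWeight; split_ifs
    · exact le_rfl
    · rw [zero_div]; positivity

/-- Now `j` is fixed and `c` runs through the positive integers, giving the moments of `exp (-Q_m
Z(n))` on `Z(p,n) = j`. -/
theorem tendsto_integral_reduced_pow (hξ : IsOffspringFamily P ν ξ)
    (hν : CriticalOffspring α L ν) (hα : 0 < α) (hx : 0 < x) (hs : IndexScaling x m p k)
    {M : Measure ℝ} (hM : IsSlackLaw α M) {j : ℕ} (hj : 1 ≤ j) (i : ℕ) :
    Tendsto (fun n => ∫ ω, reducedWeight ν ξ m p j n ω * expPop ν ξ m n ω ^ (i + 1) ∂P) atTop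
      (𝓝 (∫ y, x * negBinCoeff α j * Real.exp (-(x ^ (1 / α) * y)) ^ (i + 1) ∂(convPow M j))) := by
  rw [hM.integral_convPow_pow hα hx, mul_assoc]
  refine (hξ.tendsto_integral_reduced_exp hν hα hx hs (show (0 : ℝ) < i + 1 by positivity)
    hj).congr fun n => ?_
  refine integral_congr_ae (Eventually.of_forall fun ω => ?_)
  simp only [reducedWeight, expPop_pow]
  push_cast
  split_ifs <;> ring

/-- For `j ≥ 1` the event `Z(p,n) = j` implies survival, so its weight is dominated by the survival
weight, whose limit is absolutely continuous. -/
theorem ae_ne_convPow (hξ : IsOffspringFamily P ν ξ)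
    (hν : CriticalOffspring α L ν) (hα : 0 < α) (hx : 0 < x) (hs : IndexScaling x m p k)
    {M : Measure ℝ} (hM : IsSlackLaw α M) {j : ℕ} (hj : 1 ≤ j) :
    ∀ᵐ y ∂(convPow M j), Real.exp (-(x ^ (1 / α) * y)) ≠ Real.exp (-1) := by
  have := hξ.isProbabilityMeasure_law
  have hB : 0 < x * negBinCoeff α j := mul_pos hx (negBinCoeff_pos hα j)
  refine UnitWeight.ae_ne_of_le (l := atTop) (hξ.unitWeight_reduced hν m p j)
    (hξ.unitWeight_alive hν m) ?_ (hM.unitWeight_convPow hx hB.le j) (unitWeight_gamma hα)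
    (hξ.tendsto_integral_reduced_pow hν hα hx hs hM hj)
    (hξ.tendsto_integral_alive_pow hν hα hs.tendsto_m hs.m_div) (Real.exp_pos _) ?_
    (Eventually.of_forall fun _ => hB)
  · filter_upwards [hs.add_eq] with n hn ω
    have := scale_nonneg hν m n
    unfold reducedWeight aliveWeight
    gcongr
    by_cases hZ : popSize (fun u => ξ u ω) n = 0
    · have h1 := (reducedSize_eq_zero_iff (fun u => ξ u ω) (p n) (k n)).2 (by rw [hn]; exact hZ)
      rw [hn] at h1
      rw [if_neg (by omega), if_pos hZ]
    · rw [if_neg hZ]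
      split_ifs <;> norm_num
  · refine ae_restrict_of_ae ?_
    filter_upwards [Measure.ae_ne volume (1 : ℝ)] with y hy
    simpa using hy

theorem tendsto_integral_reduced_ite (hξ : IsOffspringFamily P ν ξ)
    (hν : CriticalOffspring α L ν) (hα : 0 < α) (hx : 0 < x) (hs : IndexScaling x m p k)
    {M : Measure ℝ} (hM : IsSlackLaw α M) {j : ℕ} (hj : 1 ≤ j) :
    Tendsto (fun n => ∫ ω, (if Real.exp (-1) ≤ expPop ν ξ m n ω then
        reducedWeight ν ξ m p j n ω else 0) ∂P) atTop
      (𝓝 (x * negBinCoeff α j * (convPow M j).real (Set.Iic (x ^ (-(1 / α)))))) := by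
  rw [← IsSlackLaw.integral_ite_convPow hx]
  have hB : 0 < x * negBinCoeff α j := mul_pos hx (negBinCoeff_pos hα j)
  exact UnitWeight.tendsto_integral_ite (hξ.unitWeight_reduced hν m p j)
    (hM.unitWeight_convPow hx hB.le j) (hξ.tendsto_integral_reduced_pow hν hα hx hs hM hj)
    (Real.exp_pos _) (hξ.ae_ne_convPow hν hα hx hs hM hj)

theorem mem_smallDev_iff (hξ : IsOffspringFamily P ν ξ) (hν : CriticalOffspring α L ν) {n : ℕ}
    {ω : Ω} : ω ∈ smallDev ν ξ (m n) n ↔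
      popSize (fun u => ξ u ω) n ≠ 0 ∧ Real.exp (-1) ≤ expPop ν ξ m n ω := by
  have := hξ.isProbabilityMeasure_law
  have h0 := hν.regVarStep.orbit_pos (m n)
  have h1 : 1 - (genFun ν)^[m n] 0 = (survival ν)^[m n] 1 := by
    rw [survival_iterate, sub_self]
  have h2 : ω ∈ smallDev ν ξ (m n) n ↔ 0 < (1 - (genFun ν)^[m n] 0) *
      (popSize (fun u => ξ u ω) n : ℝ) ∧
      (1 - (genFun ν)^[m n] 0) * (popSize (fun u => ξ u ω) n : ℝ) ≤ 1 := Iff.rfl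
  rw [h2, h1, expPop, Real.exp_le_exp, neg_le_neg_iff, mul_pos_iff_of_pos_left h0, Nat.cast_pos,
    pos_iff_ne_zero]

theorem measurableSet_smallDev (hξ : IsOffspringFamily P ν ξ) (hν : CriticalOffspring α L ν)
    (m : ℕ → ℕ) (n : ℕ) : MeasurableSet (smallDev ν ξ (m n) n) := by
  have : smallDev ν ξ (m n) n = {ω | popSize (fun u => ξ u ω) n = 0}ᶜ ∩
      {ω | Real.exp (-1) ≤ expPop ν ξ m n ω} := by
    ext ω; rw [hξ.mem_smallDev_iff hν]; rfl
  rw [this]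
  exact (hξ.measurable_popSize n (measurableSet_singleton 0)).compl.inter
    (measurableSet_le measurable_const (hξ.measurable_expPop m n))

theorem integral_alive_ite_eq (hξ : IsOffspringFamily P ν ξ) (hν : CriticalOffspring α L ν)
    (m : ℕ → ℕ) (n : ℕ) :
    ∫ ω, (if Real.exp (-1) ≤ expPop ν ξ m n ω then aliveWeight ν ξ m n ω else 0) ∂P =
      P.real (smallDev ν ξ (m n) n) / scale ν m n := by
  classical
  rw [← integral_indicator_one (hξ.measurableSet_smallDev hν m n), ← integral_div]
  refine integral_congr_ae (Eventually.of_forall fun ω => ?_)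
  simp only [Set.indicator_apply, hξ.mem_smallDev_iff hν, aliveWeight]
  split_ifs <;> simp_all

theorem integral_reduced_ite_eq (hξ : IsOffspringFamily P ν ξ) (hν : CriticalOffspring α L ν)
    {n : ℕ} (hn : p n + k n = n) {j : ℕ} (hj : 1 ≤ j) :
    ∫ ω, (if Real.exp (-1) ≤ expPop ν ξ m n ω then reducedWeight ν ξ m p j n ω else 0) ∂P =
      P.real (smallDev ν ξ (m n) n ∩ {ω | reducedSize (fun u => ξ u ω) (p n) n = j}) /
        scale ν m n := by
  classical
  have hmeas : MeasurableSet {ω | reducedSize (fun u => ξ u ω) (p n) n = j} :=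
    hξ.measurable_reducedSize (p n) n (measurableSet_singleton j)
  rw [← integral_indicator_one ((hξ.measurableSet_smallDev hν m n).inter hmeas), ← integral_div]
  refine integral_congr_ae (Eventually.of_forall fun ω => ?_)
  have hmem : ω ∈ {ω | reducedSize (fun u => ξ u ω) (p n) n = j} ↔
    reducedSize (fun u => ξ u ω) (p n) n = j := Iff.rfl
  simp only [Set.indicator_apply, Set.mem_inter_iff, hξ.mem_smallDev_iff hν, reducedWeight, hmem]
  by_cases hR : reducedSize (fun u => ξ u ω) (p n) n = j
  · have hZ : popSize (fun u => ξ u ω) n ≠ 0 := fun hZ => by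
      have := (reducedSize_eq_zero_iff (fun u => ξ u ω) (p n) (k n)).2 (by rw [hn]; exact hZ)
      rw [hn] at this
      omega
    simp only [hR]
    split_ifs <;> simp_all
  · simp [hR]

/-- Limit of the conditional law of the reduced process under small deviations. -/
theorem tendsto_cond_reducedSize (hξ : IsOffspringFamily P ν ξ) (hν : CriticalOffspring α L ν)
    (hα : 0 < α) (hx : 0 < x) (hs : IndexScaling x m p k) {M : Measure ℝ} (hM : IsSlackLaw α M)
    {j : ℕ} (hj : 1 ≤ j) :
    Tendsto (fun n => (P[|smallDev ν ξ (m n) n]).real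
        {ω | reducedSize (fun u => ξ u ω) (p n) n = j}) atTop
      (𝓝 (α * Real.Gamma (j + α) / j.factorial * x *
        (convPow M j).real (Set.Iic (x ^ (-(1 / α)))))) := by
  have := hξ.isProbabilityMeasure_law
  have hΓ := Real.Gamma_pos_of_pos hα
  have hΓ' : 0 < Real.Gamma (α + 1) := Real.Gamma_pos_of_pos (by positivity)
  have h1 := (hξ.tendsto_integral_reduced_ite hν hα hx hs hM hj).div
    (hξ.tendsto_integral_alive_ite hν hα hs.tendsto_m hs.m_div) (by positivity)
  -- `Γ(α + 1) = α Γ(α)` cancels the `Γ(α)` in the coefficient and leaves the factor `α`.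
  have hval : x * negBinCoeff α j * (convPow M j).real (Set.Iic (x ^ (-(1 / α)))) /
      (1 / Real.Gamma (α + 1)) = α * Real.Gamma (j + α) / j.factorial * x *
        (convPow M j).real (Set.Iic (x ^ (-(1 / α)))) := by
    rw [negBinCoeff, Real.Gamma_add_one hα.ne']
    field_simp
  rw [hval] at h1
  refine h1.congr' ?_
  filter_upwards [hs.add_eq, hs.tendsto_m.eventually (eventually_gt_atTop 0)] with n hn hm
  have hsc : scale ν m n ≠ 0 :=
    (mul_pos (by exact_mod_cast hm) (hν.regVarStep.incr_pos n)).ne'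
  simp only [Pi.div_apply]
  rw [hξ.integral_alive_ite_eq hν, hξ.integral_reduced_ite_eq hν hn hj,
    div_div_div_cancel_right₀ hsc, div_eq_inv_mul]
  symm
  rw [Measure.real, cond_apply (hξ.measurableSet_smallDev hν m n), ENNReal.toReal_mul,
    ENNReal.toReal_inv]
  rfl

end IsOffspringFamily
-- Index sequences, uniqueness and existence of the limit law
theorem indexScaling_floor {φ : ℕ → ℝ} (hφ : Tendsto φ atTop atTop)
    (hφn : Tendsto (fun n : ℕ => φ n / (n : ℝ)) atTop (𝓝 0)) {x : ℝ} (hx : 0 < x) :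
    IndexScaling x (fun n => ⌊φ n⌋₊) (fun n => ⌊(n : ℝ) - x * φ n⌋₊)
      (fun n => n - ⌊(n : ℝ) - x * φ n⌋₊) := by
  have hpos : ∀ᶠ n in atTop, 0 < φ n := hφ.eventually (eventually_gt_atTop 0)
  have hfl : Tendsto (fun n => (⌊φ n⌋₊ : ℝ) / φ n) atTop (𝓝 1) :=
    (tendsto_nat_floor_div_atTop (R := ℝ)).comp hφ
  have hle : ∀ᶠ n : ℕ in atTop, x * φ n ≤ n := by
    filter_upwards [hφn.eventually (gt_mem_nhds (inv_pos.2 hx)), eventually_gt_atTop 0]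
      with n hn hn0
    have e : (0 : ℝ) < n := by exact_mod_cast hn0
    rw [div_lt_iff₀ e, inv_mul_eq_div, lt_div_iff₀ hx] at hn
    linarith
  have hfloor : ∀ᶠ n : ℕ in atTop, ⌊(n : ℝ) - x * φ n⌋₊ ≤ n := by
    filter_upwards [hpos] with n hn
    refine Nat.floor_le_of_le ?_
    nlinarith
  refine ⟨tendsto_nat_floor_atTop.comp hφ, ?_, ?_, ?_⟩
  · have := hfl.mul hφn
    rw [mul_zero] at this
    refine this.congr' ?_
    filter_upwards [hpos] with n hn
    field_simp
  · have hk : Tendsto (fun n : ℕ => ((n - ⌊(n : ℝ) - x * φ n⌋₊ : ℕ) : ℝ) / φ n) atTop (𝓝 x) := by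
      have hinv : Tendsto (fun n => x + (φ n)⁻¹) atTop (𝓝 (x + 0)) :=
        (tendsto_inv_atTop_zero.comp hφ).const_add x
      rw [add_zero] at hinv
      -- The floor puts `k n` between `x * φ n` and `x * φ n + 1`.
      refine tendsto_of_tendsto_of_tendsto_of_le_of_le' tendsto_const_nhds hinv ?_ ?_
      · filter_upwards [hpos, hle, hfloor] with n h1 h2 h3
        rw [le_div_iff₀ h1, Nat.cast_sub h3]
        linarith [Nat.floor_le (sub_nonneg.2 h2)]
      · filter_upwards [hpos, hfloor] with n h1 h3
        rw [div_le_iff₀ h1, Nat.cast_sub h3, add_mul, inv_mul_cancel₀ h1.ne']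
        linarith [Nat.lt_floor_add_one ((n : ℝ) - x * φ n)]
    have := hk.div hfl one_ne_zero
    rw [div_one] at this
    refine this.congr' ?_
    filter_upwards [hpos] with n hn
    simp only [Pi.div_apply]
    rw [div_div_div_cancel_right₀ hn.ne']
  · filter_upwards [hfloor] with n hn
    omega

namespace IsSlackLaw

variable {α : ℝ}

/-- The Laplace transform at positive integers gives the moments of `exp (-y)`, and these determine
the distribution function. -/
theorem unique {M₁ M₂ : Measure ℝ} (h₁ : IsSlackLaw α M₁) (h₂ : IsSlackLaw α M₂) : M₁ = M₂ := by
  have := h₁.prob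
  have := h₂.prob
  have hw : ∀ {M : Measure ℝ}, IsSlackLaw α M →
      UnitWeight M (fun _ => 1) (fun y => Real.exp (-y)) := fun {M} h => by
    have := h.prob
    have hmem : ∀ᵐ y ∂M, Real.exp (-y) ∈ Set.Icc (0 : ℝ) 1 := by
      filter_upwards [h.ae_nonneg] with y hy using exp_neg_mem_Icc hy
    have hmeas : Measurable fun y : ℝ => Real.exp (-y) := by fun_prop
    refine ⟨hmeas.aemeasurable, ?_, Eventually.of_forall fun _ => zero_le_one, hmem⟩
    refine Integrable.const_mul (Integrable.of_bound hmeas.aestronglyMeasurable 1 ?_) 1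
    filter_upwards [hmem] with y hy
    rw [Real.norm_eq_abs, abs_of_nonneg hy.1]
    exact hy.2
  have hmom : ∀ {M : Measure ℝ}, IsSlackLaw α M → ∀ k : ℕ,
      ∫ y, 1 * Real.exp (-y) ^ (k + 1) ∂M =
        1 - 1 / (1 + ((k : ℝ) + 1) ^ (-α)) ^ (1 / α) := fun {M} h k => by
    rw [← h.laplace _ (by positivity)]
    refine integral_congr_ae (Eventually.of_forall fun y => ?_)
    simp only
    rw [one_mul, ← Real.exp_nat_mul]
    push_cast
    ring_nf
  have hIic : ∀ (M : Measure ℝ) (a : ℝ),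
      ∫ y, (if Real.exp (-a) ≤ Real.exp (-y) then (1 : ℝ) else 0) ∂M = M.real (Set.Iic a) :=
    fun M a => by
      rw [← integral_indicator_one measurableSet_Iic]
      refine integral_congr_ae (Eventually.of_forall fun y => ?_)
      simp [Set.indicator_apply]
  refine Measure.ext_of_Iic _ _ fun a => ?_
  have := (hw h₁).integral_ite_eq_of_moments (hw h₂)
    (fun k => (hmom h₁ k).trans (hmom h₂ k).symm) (Real.exp_pos (-a))
  rw [hIic, hIic] at this
  exact (measureReal_eq_measureReal_iff).1 this

/-- A law on `[0, 1]` with real moments `1 - (1 + l ^ (-α)) ^ (-1 / α)` gives the Slack law. -/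
theorem of_unitInterval (hα : 0 < α) (μ : Measure unitInterval) [IsProbabilityMeasure μ]
    (hμ : ∀ l : ℝ, 0 < l → ∫ t, (t : ℝ) ^ l ∂μ = 1 - 1 / (1 + l ^ (-α)) ^ (1 / α)) :
    IsSlackLaw α (μ.map fun t : unitInterval => -Real.log t) := by
  have hmeas : Measurable fun t : unitInterval => -Real.log t := by fun_prop
  -- no mass at zero
  have hzero : ∀ᵐ t : unitInterval ∂μ, (t : ℝ) ≠ 0 := by
    have hset : MeasurableSet {t : unitInterval | (t : ℝ) ≠ 0} :=
      (measurable_subtype_coe (measurableSet_singleton (0 : ℝ))).compl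
    -- The function `t ^ l` vanishes at `t = 0`, while its integral is at least `1 - l` because `(1
    -- + l ^ (-α)) ^ (1/α) ≥ 1 / l`; then `l → 0`.
    have hle : ∀ l : ℝ, 0 < l → 1 - l ≤ μ.real {t : unitInterval | (t : ℝ) ≠ 0} := by
      intro l hl
      have h1 : 1 / (1 + l ^ (-α)) ^ (1 / α) ≤ l := by
        have h2 : 0 < l ^ (-α) := by positivity
        have h3 : (l ^ (-α)) ^ (1 / α) = l⁻¹ := by
          rw [← Real.rpow_mul hl.le, neg_mul, mul_one_div_cancel hα.ne', Real.rpow_neg_one]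
        have h4 : l⁻¹ ≤ (1 + l ^ (-α)) ^ (1 / α) := by
          rw [← h3]; exact Real.rpow_le_rpow h2.le (by linarith) (by positivity)
        rw [one_div]
        exact inv_le_of_inv_le₀ hl h4
      have h5 : ∫ t, (t : ℝ) ^ l ∂μ ≤ μ.real {t : unitInterval | (t : ℝ) ≠ 0} := by
        rw [← integral_indicator_one hset]
        refine integral_mono_of_nonneg
          (Eventually.of_forall fun t => Real.rpow_nonneg t.2.1 l)
          ((integrable_const (1 : ℝ)).indicator hset) (Eventually.of_forall fun t => ?_)
        classical
        simp only [Set.indicator_apply]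
        split_ifs with h
        · exact Real.rpow_le_one t.2.1 t.2.2 hl.le
        · have h0 : (t : ℝ) = 0 := not_not.1 h
          rw [h0, Real.zero_rpow hl.ne']
      rw [hμ l hl] at h5
      linarith
    have hone : 1 ≤ μ.real {t : unitInterval | (t : ℝ) ≠ 0} := by
      refine le_of_forall_pos_le_add fun ε hε => ?_
      linarith [hle ε hε]
    have heq : μ {t : unitInterval | (t : ℝ) ≠ 0} = 1 := by
      refine le_antisymm prob_le_one ?_
      rw [← ENNReal.ofReal_one, ← ofReal_measureReal]
      exact ENNReal.ofReal_le_ofReal hone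
    exact (prob_compl_eq_zero_iff hset).2 heq
  refine ⟨Measure.isProbabilityMeasure_map hmeas.aemeasurable, ?_, fun l hl => ?_⟩
  · rw [Measure.map_apply hmeas measurableSet_Iio]
    convert measure_empty (μ := μ)
    ext t
    simp only [Set.mem_preimage, Set.mem_Iio, Set.mem_empty_iff_false, iff_false, not_lt]
    linarith [Real.log_nonpos t.2.1 t.2.2]
  · have hexp : Continuous fun y : ℝ => Real.exp (-(l * y)) := by fun_prop
    rw [integral_map hmeas.aemeasurable hexp.aestronglyMeasurable, ← hμ l hl]
    refine integral_congr_ae ?_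
    filter_upwards [hzero] with t ht
    have ht0 : 0 < (t : ℝ) := lt_of_le_of_ne t.2.1 (Ne.symm ht)
    rw [Real.rpow_def_of_pos ht0]
    ring_nf

end IsSlackLaw

namespace IsOffspringFamily

variable {Ω : Type*} [MeasurableSpace Ω] {P : Measure Ω} [IsProbabilityMeasure P] {ν : Measure ℕ}
  {ξ : List ℕ → Ω → ℕ} {α : ℝ} {L : ℝ → ℝ}

/-- Existence of the Slack law as a limit of `Q_n Z(n)` conditioned on survival. -/
theorem exists_isSlackLaw (hξ : IsOffspringFamily P ν ξ) (hν : CriticalOffspring α L ν)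
    (hα : 0 < α) : ∃ M : Measure ℝ, IsSlackLaw α M := by
  have := hξ.isProbabilityMeasure_law
  have h := hν.regVarStep
  set A : ℕ → Set Ω := fun n => {ω | popSize (fun u => ξ u ω) n = 0}ᶜ with hA
  have hAm : ∀ n, MeasurableSet (A n) := fun n =>
    (hξ.measurable_popSize n (measurableSet_singleton 0)).compl
  have hPA : ∀ n, P.real (A n) = (survival ν)^[n] 1 := fun n => by
    classical
    have h1 := hξ.integral_ite_pow_popSize (s := 1) ⟨zero_le_one, le_rfl⟩ n
    have h2 : (survival ν)^[n] 0 = 0 := by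
      refine Function.iterate_fixed ?_ n
      simp [survival, genFun]
    rw [sub_self, h2, sub_zero] at h1
    rw [← h1, ← integral_indicator_one (hAm n)]
    refine integral_congr_ae (Eventually.of_forall fun ω => ?_)
    have hmem : ω ∈ A n ↔ ¬ popSize (fun u => ξ u ω) n = 0 := Iff.rfl
    simp only [Set.indicator_apply, hmem]
    split_ifs <;> simp_all
  have hPA0 : ∀ n, P (A n) ≠ 0 := fun n h0 => by
    have h1 := h.orbit_pos n
    rw [← hPA n, Measure.real, h0] at h1
    simp at h1
  set T : ℕ → Ω → unitInterval := fun n ω => ⟨expPop ν ξ id n ω, expPop_mem hν id n ω⟩ with hT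
  have hTm : ∀ n, Measurable (T n) := fun n => (hξ.measurable_expPop id n).subtype_mk
  have hprob : ∀ n, IsProbabilityMeasure ((P[|A n]).map (T n)) := fun n => by
    have := cond_isProbabilityMeasure (hPA0 n)
    exact Measure.isProbabilityMeasure_map (hTm n).aemeasurable
  set μ : ℕ → ProbabilityMeasure unitInterval := fun n => ⟨(P[|A n]).map (T n), hprob n⟩ with hμ
  have hlim : ∀ l : ℝ, 0 < l → Tendsto (fun n => ∫ t, (t : ℝ) ^ l ∂(μ n : Measure unitInterval))
      atTop (𝓝 (1 - 1 / (1 + l ^ (-α)) ^ (1 / α))) := by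
    intro l hl
    -- Taking both index sequences equal to `n` is the case `x = 1` of the iterate asymptotics.
    have hone : Tendsto (fun n : ℕ => ((id n : ℕ) : ℝ) / ((id n : ℕ) : ℝ)) atTop (𝓝 1) := by
      refine tendsto_const_nhds.congr' ?_
      filter_upwards [eventually_gt_atTop 0] with n hn
      have : (n : ℝ) ≠ 0 := by exact_mod_cast hn.ne'
      simp [this]
    have h1 := (h.tendsto_iterate_div_orbit hα hl one_pos tendsto_id tendsto_id hone
      (fun n => (h.one_sub_exp_mem hl n).2)
      (tendsto_one_sub_exp_div h.tendsto_orbit)).const_sub 1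
    rw [div_one, Real.rpow_neg (x := 1 + l ^ (-α)) (by positivity), ← one_div (_ ^ _)] at h1
    refine h1.congr fun n => ?_
    have h0 := h.orbit_pos n
    have hcont : Continuous fun t : unitInterval => (t : ℝ) ^ l :=
      continuous_subtype_val.rpow_const fun _ => Or.inr hl.le
    have h2 : ∫ t, (t : ℝ) ^ l ∂(μ n : Measure unitInterval) =
        (P.real (A n))⁻¹ * ∫ ω in A n, expPop ν ξ id n ω ^ l ∂P := by
      change ∫ t, (t : ℝ) ^ l ∂((P[|A n]).map (T n)) = _
      rw [integral_map (hTm n).aemeasurable hcont.aestronglyMeasurable, ProbabilityTheory.cond,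
        integral_smul_measure, ENNReal.toReal_inv]
      rfl
    have h3 : ∫ ω in A n, expPop ν ξ id n ω ^ l ∂P =
        (survival ν)^[n] 1 - (survival ν)^[n] (1 - Real.exp (-(l * (survival ν)^[n] 1))) := by
      classical
      rw [← hξ.integral_ite_pow_popSize (exp_neg_mem_Icc (by positivity)),
        ← integral_indicator (hAm n)]
      refine integral_congr_ae (Eventually.of_forall fun ω => ?_)
      have hmem : ω ∈ A n ↔ ¬ popSize (fun u => ξ u ω) n = 0 := Iff.rfl
      simp only [Set.indicator_apply, hmem, ite_not]
      congr 1
      rw [expPop, ← Real.exp_mul, ← Real.exp_nat_mul]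
      simp only [id]
      ring_nf
    rw [h2, h3, hPA]
    simp only [id]
    field_simp
  -- Probability measures on the compact interval form a compact space, so a limit along an
  -- ultrafilter exists. The functions `t ^ l` are continuous, hence its moments are the limits
  -- already computed.
  obtain ⟨μ₀, -, hμ₀⟩ := isCompact_univ.ultrafilter_le_nhds
    ((hyperfilter ℕ).map μ) (by simp)
  have htend : Tendsto μ (hyperfilter ℕ : Filter ℕ) (𝓝 μ₀) := hμ₀
  refine ⟨_, IsSlackLaw.of_unitInterval hα (μ₀ : Measure unitInterval) fun l hl => ?_⟩
  have hcont : Continuous fun t : unitInterval => (t : ℝ) ^ l :=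
    continuous_subtype_val.rpow_const fun _ => Or.inr hl.le
  have h1 := (ProbabilityMeasure.tendsto_iff_forall_integral_tendsto.1 htend)
    (BoundedContinuousFunction.mkOfCompact ⟨_, hcont⟩)
  exact tendsto_nhds_unique h1 ((hlim l hl).mono_left Nat.hyperfilter_le_atTop)

end IsOffspringFamily
end GaltonWatson

theorem theorem2 {Ω : Type*} [MeasurableSpace Ω] (P : Measure Ω) [IsProbabilityMeasure P]
    (ν : Measure ℕ) (ξ : List ℕ → Ω → ℕ) (hξ : GaltonWatson.IsOffspringFamily P ν ξ)
    (α : ℝ) (hα₀ : 0 < α) (hα₁ : α < 1) (L : ℝ → ℝ) (hν : GaltonWatson.CriticalOffspring α L ν)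
    (φ : ℕ → ℝ) (hφ : Tendsto φ atTop atTop)
    (hφn : Tendsto (fun n : ℕ => φ n / (n : ℝ)) atTop (𝓝 0)) :
    (∃! M : Measure ℝ, GaltonWatson.IsSlackLaw α M) ∧
    ∀ M : Measure ℝ, GaltonWatson.IsSlackLaw α M →
      ∀ x : ℝ, 0 < x → ∀ j : ℕ, 1 ≤ j →
        Tendsto
          (fun n : ℕ =>
            (P[|GaltonWatson.smallDev ν ξ ⌊φ n⌋₊ n]).real
              {ω | GaltonWatson.reducedSize (fun u => ξ u ω) ⌊(n : ℝ) - x * φ n⌋₊ n = j})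
          atTop
          (𝓝 (α * Real.Gamma ((j : ℝ) + α) / (j.factorial : ℝ) * x *
            (GaltonWatson.convPow M j).real (Set.Iic (x ^ (-(1 / α)))))) := by
  obtain ⟨M, hM⟩ := hξ.exists_isSlackLaw hν hα₀
  refine ⟨⟨M, hM, fun M' hM' => hM'.unique hM⟩, fun M hM x hx j hj => ?_⟩
  exact hξ.tendsto_cond_reducedSize hν hα₀ hx (GaltonWatson.indexScaling_floor hφ hφn hx) hM hj
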